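/- **Setting.** A general probabilistic theory (GPT) is a triple $(V,C,u)$ with $V$ a finite-dimensional real vector space, $C\subset V$ a closed, convex, salient, generating cone and $u\in\mathrm{int}(C^*)$. Its states are the $\rho\in C$ with $u(\rho)=1$; its measurements are the finite families $(e_i)$ in $C^*$ with $\sum_i e_i=u$; its base norm is $\|x\|=\max\{f(x): -u\le f\le u\}$. For a set $\mathcal M$ of measurements put $\|x\|_{\mathcal M}=\sup_{(e_i)\in\mathcal M}\sum_i|e_i(x)|$ and $P_e^{\mathcal M}(\rho,\sigma;p)=\frac12\big(1-\|p\rho-(1-p)\sigma\|_{\mathcal M}\big)$. The data hiding ratio $R(\mathcal M)$ is the largest $R\ge 1$ for which there are states $\rho,\sigma$ and $p\in[0,1]$ with $P_e(\rho,\sigma;p)=0$ for the set of all measurements and $P_e^{\mathcal M}(\rho,\sigma;p)=\frac12(1-\frac1R)$. For $n\ge1$ the cubic model $G_n$ is the GPT $(\mathbb R\oplus\mathbb R^n,\ \{(x_0,x):|x|_\infty\le x_0\},\ (x_0,x)\mapsto x_0)$, of dimension $n+1$. The minimal tensor product of $A=(V_A,C_A,u_A)$ and $B=(V_B,C_B,u_B)$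 is $(V_A\otimes V_B,\ \mathrm{conv}\{a\otimes b: a\in C_A,\ b\in C_B\},\ u_A\otimes u_B)$. The locally constrained sets of measurements on a composite $AB$ are: LO (coarse grainings of product measurements $(e_i\otimes f_j)_{i,j}$); $\mathrm{LOCC}_\to$ (coarse grainings of $(e_i\otimes f^{(i)}_j)_{i,j}$, with $(e_i)_i$ a measurement on $A$ and each $(f^{(i)}_j)_j$ a measurement on $B$); LOCC (families $(\Phi_i^*(u_A\otimes u_B))_i$ with $(\Phi_i)_i$ an LOCC instrument, that is, a limit of coarse grainings of a sequence of finite-round local protocols with two-way classical communication, each extending the previous one); SEP (measurements on $AB$ all of whose elements lie in $\mathrm{conv}\{e\otimes f: e\in C_A^*,\ f\in C_B^*\}$). For $M\in\mathbb R^n\otimes\mathbb R^m$ let $\hat M$ be its image under the inclusion $\mathbb R^n\otimes\mathbb R^m\subset(\mathbb R\oplus\mathbb R^n)\otimes(\mathbb R\oplus\mathbb R^m)$. Let $|M|_\pi$ and $|M|_\varepsilon$ be the projective and the injective norm built from the local norms $|\cdot|_\infty$. The restricted data hiding ratio against $\mathcal M$ is $\bar R(\mathcal M)=\max_{M\neq0}\|\hat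 M\|/\|\hat M\|_{\mathcal M}$. **Proposition.** Let $n,m\ge1$ and let $AB$ be the minimal tensor product of $A=G_n$ and $B=G_m$. 1. The four restricted data hiding ratios coincide with one another and with the maximal ratio of the projective to the injective norm (all these maxima being attained): $$\bar R:=\bar R(\mathrm{LO})=\bar R(\mathrm{LOCC}_\to)=\bar R(\mathrm{LOCC})=\bar R(\mathrm{SEP})=\max_{0\ne M\in\mathbb R^n\otimes\mathbb R^m}\frac{|M|_\pi}{|M|_\varepsilon},$$ and $$\sqrt{\frac{\min\{n,m\}}{2}}\ \le\ \bar R\ \le\ \sqrt{2\min\{n,m\}}.$$ 2. Consequently, with $d_A=n+1$ and $d_B=m+1$ the dimensions of $A$ and $B$, all the data hiding ratios against locally constrained measurements satisfy $$R(\mathcal M)=\Theta\big(\sqrt{\min\{n,m\}}\big)=\Theta\big(\sqrt{\min\{d_A,d_B\}}\big)\qquad\text{for }\mathcal M=\mathrm{LO},\ \mathrm{LOCC}_\to,\ \mathrm{LOCC},\ \mathrm{SEP},$$ that is, there are universal constants $a,b>0$ such that, for all $n,m\ge1$ and all four sets $\mathcal M$, the ratio $R(\mathcal M)$ exists and lies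 between $a$ and $b$ times each of these square roots. -/

import Mathlib

open scoped TensorProduct Topology
open Module

namespace DataHiding

/-! ### Auxiliary facts on cones in finite-dimensional spaces

They are used only to check that the models constructed below satisfy the axioms of a general
probabilistic theory. -/

theorem sum_eq_sum_of_embedding {ι κ M : Type*} [Fintype ι] [Fintype κ] [AddCommMonoid M]
    (g : ι ↪ κ) (φ : κ → M) (ψ : ι → M) (h1 : ∀ i, φ (g i) = ψ i)
    (h2 : ∀ j, ¬ (∃ i, g i = j) → φ j = 0) : ∑ j, φ j = ∑ i, ψ i := by
  rw [← Finset.sum_subset (Finset.subset_univ (Finset.univ.map g)) (fun j _ hj => h2 j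
    (by simpa using hj)), Finset.sum_map]
  exact Finset.sum_congr rfl fun i _ => h1 i

section Aux

variable {V : Type*} [AddCommGroup V] [Module ℝ V] [FiniteDimensional ℝ V]
  [TopologicalSpace V] [IsModuleTopology ℝ V]

theorem t2Space_of_moduleTopology : T2Space V := by
  have hc : Continuous (finBasis ℝ V).equivFun :=
    IsModuleTopology.continuous_of_linearMap (finBasis ℝ V).equivFun.toLinearMap
  exact T2Space.of_injective_continuous (finBasis ℝ V).equivFun.injective hc

theorem continuous_dualPairing [TopologicalSpace (Dual ℝ V)] [IsModuleTopology ℝ (Dual ℝ V)] :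
    Continuous fun p : Dual ℝ V × V => p.1 p.2 :=
  IsModuleTopology.continuous_bilinear_of_finite_left
    (LinearMap.id : Dual ℝ V →ₗ[ℝ] V →ₗ[ℝ] ℝ)

theorem mem_interior_dual_of_compact_base [TopologicalSpace (Dual ℝ V)]
    [IsModuleTopology ℝ (Dual ℝ V)] {C : PointedCone ℝ V} {u : Dual ℝ V} {K : Set V}
    (hK : IsCompact K) (hpos : ∀ k ∈ K, 0 < u k)
    (hC : ∀ x ∈ C, ∃ t : ℝ, 0 ≤ t ∧ (t = 0 ∧ x = 0 ∨ ∃ k ∈ K, x = t • k)) :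
    u ∈ interior (PointedCone.dual (Dual.eval ℝ V) C : Set (Dual ℝ V)) := by
  rw [mem_interior_iff_mem_nhds]
  have h : ∀ᶠ f in 𝓝 u, ∀ k ∈ K, 0 < f k := by
    refine hK.eventually_forall_of_forall_eventually fun k hk => ?_
    exact (continuous_dualPairing (V := V)).continuousAt.eventually
      (lt_mem_nhds (hpos k hk))
  filter_upwards [h] with f hf x hx
  obtain ⟨t, ht, ⟨-, rfl⟩ | ⟨k, hk, rfl⟩⟩ := hC x hx
  · simp
  · simpa using mul_nonneg ht (hf k hk).le

theorem isCompact_base [TopologicalSpace (Dual ℝ V)] [IsModuleTopology ℝ (Dual ℝ V)]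
    {C : PointedCone ℝ V} {u : Dual ℝ V} (hC : IsClosed (C : Set V))
    (hu : u ∈ interior (PointedCone.dual (Dual.eval ℝ V) C : Set (Dual ℝ V))) :
    IsCompact {a | a ∈ C ∧ u a = 1} ∧ ∀ a ∈ C, u a ≤ 0 → a = 0 := by
  have : IsTopologicalAddGroup V := IsModuleTopology.topologicalAddGroup ℝ V
  have : IsTopologicalAddGroup (Dual ℝ V) := IsModuleTopology.topologicalAddGroup ℝ _
  have : ContinuousSMul ℝ (Dual ℝ V) := IsModuleTopology.toContinuousSMul ℝ _
  let b := finBasis ℝ V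
  have hb : ∀ i, ∃ δ : ℝ, 0 < δ ∧ ∀ a ∈ C, |b.coord i a| ≤ δ * u a := by
    intro i
    have hcont : Continuous fun t : ℝ => u + t • b.coord i := by fun_prop
    have hev : ∀ᶠ t : ℝ in 𝓝 0,
        u + t • b.coord i ∈ (PointedCone.dual (Dual.eval ℝ V) C : Set (Dual ℝ V)) := by
      have h0 : Filter.Tendsto (fun t : ℝ => u + t • b.coord i) (𝓝 0) (𝓝 u) :=
        hcont.tendsto' 0 u (by simp)
      exact h0.eventually (mem_interior_iff_mem_nhds.1 hu)
    obtain ⟨δ, hδ, h⟩ := Metric.eventually_nhds_iff.1 hev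
    refine ⟨(δ / 2)⁻¹, by positivity, fun a ha => ?_⟩
    have h1 := @h (δ / 2) (by simp [abs_of_pos hδ, hδ]) a ha
    have h2 := @h (-(δ / 2)) (by simp [abs_of_pos hδ, hδ]) a ha
    simp only [Dual.eval_apply, LinearMap.add_apply, LinearMap.smul_apply, smul_eq_mul] at h1 h2
    rw [inv_mul_eq_div, le_div_iff₀ (by positivity)]
    rcases abs_cases (b.coord i a) with ⟨h, -⟩ | ⟨h, -⟩ <;> rw [h] <;> linarith
  choose δ hδ hbd using hb
  constructor
  · let e : V ≃L[ℝ] (Fin (finrank ℝ V) → ℝ) :=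
      { b.equivFun with
        continuous_toFun := IsModuleTopology.continuous_of_linearMap b.equivFun.toLinearMap
        continuous_invFun := IsModuleTopology.continuous_of_linearMap b.equivFun.symm.toLinearMap }
    have hcpt : IsCompact (e.toHomeomorph ⁻¹' Set.pi Set.univ fun i => Set.Icc (-δ i) (δ i)) :=
      e.toHomeomorph.isCompact_preimage.2 (isCompact_univ_pi fun i => isCompact_Icc)
    refine hcpt.of_isClosed_subset ?_ ?_
    · exact hC.inter (isClosed_eq (IsModuleTopology.continuous_of_linearMap u) continuous_const)
    · rintro a ⟨ha, hua⟩ i -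
      have := hbd i a ha
      rw [hua, mul_one] at this
      exact abs_le.1 this
  · intro a ha hua
    refine b.ext_elem fun i => ?_
    have h1 := hbd i a ha
    have h2 : δ i * u a ≤ 0 := mul_nonpos_of_nonneg_of_nonpos (hδ i).le hua
    have h3 : b.coord i a = 0 := abs_nonpos_iff.1 (h1.trans h2)
    simpa using h3

theorem isCompact_convexHull {S : Set V} (hS : IsCompact S) : IsCompact (convexHull ℝ S) := by
  classical
  have : IsTopologicalAddGroup V := IsModuleTopology.topologicalAddGroup ℝ V
  have : ContinuousSMul ℝ V := IsModuleTopology.toContinuousSMul ℝ V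
  rcases S.eq_empty_or_nonempty with rfl | ⟨s₀, hs₀⟩
  · simp
  let N := finrank ℝ V + 1
  let F : (Fin N → ℝ) × (Fin N → V) → V := fun p => ∑ i, p.1 i • p.2 i
  have hF : Continuous F := by fun_prop
  have hK : IsCompact (F '' (stdSimplex ℝ (Fin N) ×ˢ Set.pi Set.univ fun _ => S)) :=
    ((isCompact_stdSimplex ℝ (Fin N)).prod (isCompact_univ_pi fun _ => hS)).image hF
  convert hK using 1
  ext x
  constructor
  · intro hx
    obtain ⟨ι, _, z, w, hz, hind, hw, hw1, hx⟩ := eq_pos_convex_span_of_mem_convexHull hx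
    have hcard : Fintype.card ι ≤ N :=
      hind.card_le_finrank_succ.trans (Nat.succ_le_succ (Submodule.finrank_le _))
    obtain ⟨g⟩ : Nonempty (ι ↪ Fin N) := Function.Embedding.nonempty_of_card_le (by simpa using hcard)
    refine ⟨(Function.extend g w 0, Function.extend g z fun _ => s₀), ⟨⟨fun j => ?_, ?_⟩, ?_⟩, ?_⟩
    · by_cases hj : ∃ i, g i = j
      · obtain ⟨i, rfl⟩ := hj
        simpa [g.injective.extend_apply] using (hw i).le
      · simp [Function.extend_apply' _ _ _ hj]
    · rw [← hw1]
      refine sum_eq_sum_of_embedding g _ _ (fun i => g.injective.extend_apply _ _ _)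
        (fun j hj => ?_)
      exact Function.extend_apply' _ _ _ hj
    · intro j _
      by_cases hj : ∃ i, g i = j
      · obtain ⟨i, rfl⟩ := hj
        simpa [g.injective.extend_apply] using hz ⟨i, rfl⟩
      · simpa [Function.extend_apply' _ _ _ hj] using hs₀
    · rw [← hx]
      refine sum_eq_sum_of_embedding g _ _ (fun i => ?_) (fun j hj => ?_)
      · simp [g.injective.extend_apply]
      · simp [Function.extend_apply' _ _ _ hj]
  · rintro ⟨⟨w, z⟩, ⟨⟨hw, hw1⟩, hz⟩, rfl⟩
    exact (convex_convexHull ℝ S).sum_mem (fun i _ => hw i) hw1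
      fun i _ => subset_convexHull ℝ S (hz i trivial)

theorem isClosed_cone_of_compact_base {C : PointedCone ℝ V} {u : Dual ℝ V} {K : Set V}
    (hK : IsCompact K) (hKC : K ⊆ C) (hKu : ∀ k ∈ K, u k = 1)
    (hC : ∀ x ∈ C, ∃ t : ℝ, 0 ≤ t ∧ (t = 0 ∧ x = 0 ∨ ∃ k ∈ K, x = t • k)) :
    IsClosed (C : Set V) := by
  have : IsTopologicalAddGroup V := IsModuleTopology.topologicalAddGroup ℝ V
  have : ContinuousSMul ℝ V := IsModuleTopology.toContinuousSMul ℝ V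
  have : T2Space V := t2Space_of_moduleTopology
  have hu : Continuous u := IsModuleTopology.continuous_of_linearMap u
  have hset : (C : Set V) = {0} ∪
      Prod.snd '' {p : K × V | 0 ≤ u p.2 ∧ p.2 = u p.2 • (p.1 : V)} := by
    ext x
    constructor
    · intro hx
      obtain ⟨t, ht, ⟨-, rfl⟩ | ⟨k, hk, rfl⟩⟩ := hC x hx
      · exact Or.inl rfl
      · exact Or.inr ⟨(⟨k, hk⟩, t • k), by simp [hKu k hk, ht], rfl⟩
    · rintro (rfl | ⟨⟨k, y⟩, ⟨h1, h2⟩, rfl⟩)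
      · exact C.zero_mem
      · change y ∈ C
        rw [show y = u y • (k : V) from h2]
        exact C.smul_mem h1 (hKC k.2)
  have : CompactSpace K := isCompact_iff_compactSpace.1 hK
  rw [hset]
  refine isClosed_singleton.union (isClosedMap_snd_of_compactSpace _ ?_)
  have h1 : Continuous fun p : K × V => u p.2 := hu.comp continuous_snd
  have h2 : Continuous fun p : K × V => u p.2 • (p.1 : V) :=
    h1.smul (continuous_subtype_val.comp continuous_fst)
  exact (isClosed_le continuous_const h1).inter (isClosed_eq continuous_snd h2)

end Aux

/-! ### General probabilistic theories -/

/-- A general probabilistic theory `(V, C, u)`: a finite-dimensional real vector space `V` (with its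
canonical topology), a closed, convex, salient and generating cone `C`, and a strictly positive
functional `u`, that is, an interior point of the dual cone. -/
structure GPT (V : Type*) [AddCommGroup V] [Module ℝ V] [FiniteDimensional ℝ V] where
  cone : PointedCone ℝ V
  unit : Dual ℝ V
  isClosed_cone : IsClosed[moduleTopology ℝ V] (cone : Set V)
  salient : ∀ x ∈ cone, -x ∈ cone → x = 0
  generating : Submodule.span ℝ (cone : Set V) = ⊤
  unit_mem_interior : unit ∈ @interior (Dual ℝ V) (moduleTopology ℝ (Dual ℝ V))
    (PointedCone.dual (Dual.eval ℝ V) (cone : Set V) : Set (Dual ℝ V))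

/-- Finite families of linear functionals on `V`, labelled by `0, …, k - 1` for some `k`. -/
abbrev FunctionalFamily (V : Type*) [AddCommGroup V] [Module ℝ V] : Type _ :=
  Σ k : ℕ, (Fin k → Dual ℝ V)

namespace GPT

variable {V : Type*} [AddCommGroup V] [Module ℝ V] [FiniteDimensional ℝ V]

/-- The dimension of a theory. -/
noncomputable def dim (_A : GPT V) : ℕ := finrank ℝ V

/-- The dual cone `C*`. -/
def dualCone (A : GPT V) : PointedCone ℝ (Dual ℝ V) :=
  PointedCone.dual (Dual.eval ℝ V) (A.cone : Set V)

/-- The normalised states. -/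
def states (A : GPT V) : Set V := {ρ | ρ ∈ A.cone ∧ A.unit ρ = 1}

/-- The effects: the order interval `[0, u]`. -/
def effects (A : GPT V) : Set (Dual ℝ V) := {e | e ∈ A.dualCone ∧ A.unit - e ∈ A.dualCone}

/-- The set of all measurements. -/
def measurements (A : GPT V) : Set (FunctionalFamily V) :=
  {e | (∀ i, e.2 i ∈ A.effects) ∧ ∑ i, e.2 i = A.unit}

/-- The base norm `‖x‖ = max {f x : -u ≤ f ≤ u}`. -/
noncomputable def baseNorm (A : GPT V) (x : V) : ℝ :=
  sSup {r | ∃ f : Dual ℝ V, A.unit - f ∈ A.dualCone ∧ f + A.unit ∈ A.dualCone ∧ r = f x}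

end GPT

/-- The distinguishability norm `‖x‖_𝓜 = sup_{(e_i) ∈ 𝓜} ∑ i, |e_i x|`. -/
noncomputable def distNorm {V : Type*} [AddCommGroup V] [Module ℝ V]
    (𝓜 : Set (FunctionalFamily V)) (x : V) : ℝ :=
  sSup {r | ∃ e ∈ 𝓜, r = ∑ i, |e.2 i x|}

/-- The lowest probability of error in the discrimination of `ρ` and `σ`, with a priori
probabilities `p` and `1 - p`, by means of measurements in `𝓜`. -/
noncomputable def errorProb {V : Type*} [AddCommGroup V] [Module ℝ V]
    (𝓜 : Set (FunctionalFamily V)) (ρ σ : V) (p : ℝ) : ℝ :=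
  (1 - distNorm 𝓜 (p • ρ - (1 - p) • σ)) / 2

/-- The set of efficiencies `R ≥ 1` of data hiding against `𝓜`. The data hiding ratio `R(𝓜)` is its
greatest element. -/
def dataHidingEfficiencies {V : Type*} [AddCommGroup V] [Module ℝ V] [FiniteDimensional ℝ V]
    (A : GPT V) (𝓜 : Set (FunctionalFamily V)) : Set ℝ :=
  {R | 1 ≤ R ∧ ∃ ρ ∈ A.states, ∃ σ ∈ A.states, ∃ p ∈ Set.Icc (0 : ℝ) 1,
    errorProb A.measurements ρ σ p = 0 ∧ errorProb 𝓜 ρ σ p = 1 / 2 * (1 - 1 / R)}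

/-- `E'` arises from the finite family `E` by coarse graining: the labels of `E` are partitioned into
non-empty classes, labelled by `κ`, and `E` is summed over each class. -/
def IsCoarseGraining {W ι κ : Type*} [AddCommMonoid W] [Fintype ι] (E : ι → W) (E' : κ → W) :
    Prop :=
  open Classical in
  ∃ g : ι → κ, Function.Surjective g ∧ ∀ j, E' j = ∑ i with g i = j, E i

/-! ### Bipartite systems -/

section Bipartite

variable {V W : Type*} [AddCommGroup V] [Module ℝ V] [FiniteDimensional ℝ V]
  [AddCommGroup W] [Module ℝ W] [FiniteDimensional ℝ W]

/-- The product functional `e ⊗ f` on `V ⊗ W`. -/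
noncomputable def prodFunctional (e : Dual ℝ V) (f : Dual ℝ W) : Dual ℝ (V ⊗[ℝ] W) :=
  TensorProduct.dualDistrib ℝ V W (e ⊗ₜ[ℝ] f)

theorem minTensor_base (A : GPT V) (B : GPT W) :
    let _ : TopologicalSpace (V ⊗[ℝ] W) := moduleTopology ℝ (V ⊗[ℝ] W)
    ∃ K : Set (V ⊗[ℝ] W), IsCompact K ∧
      K ⊆ (PointedCone.minTensorProduct A.cone B.cone : Set (V ⊗[ℝ] W)) ∧
      (∀ k ∈ K, prodFunctional A.unit B.unit k = 1) ∧
      ∀ x ∈ PointedCone.minTensorProduct A.cone B.cone,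
        ∃ t : ℝ, 0 ≤ t ∧ (t = 0 ∧ x = 0 ∨ ∃ k ∈ K, x = t • k) := by
  let _ : TopologicalSpace V := moduleTopology ℝ V
  let _ : TopologicalSpace W := moduleTopology ℝ W
  let _ : TopologicalSpace (V ⊗[ℝ] W) := moduleTopology ℝ (V ⊗[ℝ] W)
  let _ : TopologicalSpace (Dual ℝ V) := moduleTopology ℝ _
  let _ : TopologicalSpace (Dual ℝ W) := moduleTopology ℝ _
  have : IsModuleTopology ℝ V := ⟨rfl⟩
  have : IsModuleTopology ℝ W := ⟨rfl⟩
  have : IsModuleTopology ℝ (V ⊗[ℝ] W) := ⟨rfl⟩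
  have : IsModuleTopology ℝ (Dual ℝ V) := ⟨rfl⟩
  have : IsModuleTopology ℝ (Dual ℝ W) := ⟨rfl⟩
  obtain ⟨hA, hA0⟩ := isCompact_base A.isClosed_cone A.unit_mem_interior
  obtain ⟨hB, hB0⟩ := isCompact_base B.isClosed_cone B.unit_mem_interior
  have hmk : Continuous fun p : V × W => p.1 ⊗ₜ[ℝ] p.2 :=
    IsModuleTopology.continuous_bilinear_of_finite_left (TensorProduct.mk ℝ V W)
  let S : Set (V ⊗[ℝ] W) := (fun p : V × W => p.1 ⊗ₜ[ℝ] p.2) ''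
    ({a | a ∈ A.cone ∧ A.unit a = 1} ×ˢ {b | b ∈ B.cone ∧ B.unit b = 1})
  have hS : IsCompact S := (hA.prod hB).image hmk
  refine ⟨convexHull ℝ S, isCompact_convexHull hS, ?_, ?_, ?_⟩
  · refine convexHull_min ?_ (PointedCone.convex _)
    rintro _ ⟨⟨a, b⟩, ⟨⟨ha, -⟩, ⟨hb, -⟩⟩, rfl⟩
    exact PointedCone.tmul_mem_minTensorProduct ha hb
  · have hconv : Convex ℝ {k : V ⊗[ℝ] W | prodFunctional A.unit B.unit k = 1} :=
      convex_hyperplane (LinearMap.isLinear _) 1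
    refine convexHull_min ?_ hconv
    rintro _ ⟨⟨a, b⟩, ⟨⟨-, ha⟩, ⟨-, hb⟩⟩, rfl⟩
    have ha' : A.unit a = 1 := ha
    have hb' : B.unit b = 1 := hb
    change prodFunctional A.unit B.unit (a ⊗ₜ[ℝ] b) = 1
    simp [prodFunctional, ha', hb']
  · intro x hx
    unfold PointedCone.minTensorProduct PointedCone.hull at hx
    induction hx using Submodule.span_induction with
    | mem x hx =>
      obtain ⟨a, ha, b, hb, rfl⟩ := hx
      rcases le_or_gt (A.unit a) 0 with h1 | h1
      · exact ⟨0, le_rfl, Or.inl ⟨rfl, by simp [hA0 a ha h1]⟩⟩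
      rcases le_or_gt (B.unit b) 0 with h2 | h2
      · exact ⟨0, le_rfl, Or.inl ⟨rfl, by simp [hB0 b hb h2]⟩⟩
      refine ⟨A.unit a * B.unit b, by positivity, Or.inr
        ⟨((A.unit a)⁻¹ • a) ⊗ₜ[ℝ] ((B.unit b)⁻¹ • b), subset_convexHull ℝ S
          ⟨(_, _), ⟨⟨?_, ?_⟩, ⟨?_, ?_⟩⟩, rfl⟩, ?_⟩⟩
      · exact A.cone.smul_mem (by positivity) ha
      · simp [h1.ne']
      · exact B.cone.smul_mem (by positivity) hb
      · simp [h2.ne']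
      · rw [TensorProduct.smul_tmul_smul, smul_smul, ← mul_inv, mul_inv_cancel₀ (by positivity),
          one_smul]
    | zero => exact ⟨0, le_rfl, Or.inl ⟨rfl, rfl⟩⟩
    | add x y _ _ hx hy =>
      obtain ⟨s, hs, ⟨-, rfl⟩ | ⟨k, hk, rfl⟩⟩ := hx
      · simpa using hy
      obtain ⟨t, ht, ⟨-, rfl⟩ | ⟨l, hl, rfl⟩⟩ := hy
      · exact ⟨s, hs, Or.inr ⟨k, hk, by simp⟩⟩
      rcases (add_nonneg hs ht).eq_or_lt with h0 | h0
      · have hs0 : s = 0 := by linarith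
        have ht0 : t = 0 := by linarith
        exact ⟨0, le_rfl, Or.inl ⟨rfl, by simp [hs0, ht0]⟩⟩
      · refine ⟨s + t, h0.le, Or.inr ⟨(s / (s + t)) • k + (t / (s + t)) • l,
          convex_convexHull ℝ S hk hl (by positivity) (by positivity) (by field_simp), ?_⟩⟩
        rw [smul_add, smul_smul, smul_smul, mul_div_cancel₀ _ h0.ne', mul_div_cancel₀ _ h0.ne']
    | smul c x _ hx =>
      obtain ⟨t, ht, ⟨rfl, rfl⟩ | ⟨k, hk, rfl⟩⟩ := hx
      · exact ⟨0, le_rfl, Or.inl ⟨rfl, by simp⟩⟩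
      · exact ⟨c * t, mul_nonneg c.2 ht, Or.inr ⟨k, hk, by
          rw [mul_smul]; rfl⟩⟩

/-- The minimal tensor product of two theories: the space `V ⊗ W`, the cone generated by (which is
also the convex hull of) the product vectors `a ⊗ b` with `a`, `b` in the local cones, and the unit
effect `u_A ⊗ u_B`. -/
noncomputable def GPT.minTensor (A : GPT V) (B : GPT W) : GPT (V ⊗[ℝ] W) where
  cone := PointedCone.minTensorProduct A.cone B.cone
  unit := prodFunctional A.unit B.unit
  isClosed_cone := by
    let _ : TopologicalSpace (V ⊗[ℝ] W) := moduleTopology ℝ (V ⊗[ℝ] W)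
    have : IsModuleTopology ℝ (V ⊗[ℝ] W) := ⟨rfl⟩
    obtain ⟨K, h1, h2, h3, h4⟩ := minTensor_base A B
    exact isClosed_cone_of_compact_base h1 h2 h3 h4
  salient := by
    obtain ⟨K, -, -, h3, h4⟩ := minTensor_base A B
    intro x hx hx'
    obtain ⟨s, hs, ⟨-, rfl⟩ | ⟨k, hk, rfl⟩⟩ := h4 x hx
    · rfl
    obtain ⟨t, ht, ⟨-, h⟩ | ⟨l, hl, h⟩⟩ := h4 _ hx'
    · simpa using h
    · have := congrArg (prodFunctional A.unit B.unit) h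
      simp only [map_neg, map_smul, h3 k hk, h3 l hl, smul_eq_mul, mul_one] at this
      have hs0 : s = 0 := by linarith
      simp [hs0]
  generating := by
    rw [eq_top_iff, ← TensorProduct.span_tmul_eq_top]
    refine Submodule.span_le.2 ?_
    rintro _ ⟨v, w, rfl⟩
    have hv : v ∈ Submodule.span ℝ (A.cone : Set V) := A.generating ▸ Submodule.mem_top
    have hw : w ∈ Submodule.span ℝ (B.cone : Set W) := B.generating ▸ Submodule.mem_top
    have h := Submodule.apply_mem_map₂ (TensorProduct.mk ℝ V W) hv hw
    rw [Submodule.map₂_span_span] at h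
    exact Submodule.span_mono (PointedCone.tmul_subset_minTensorProduct _ _) h
  unit_mem_interior := by
    let _ : TopologicalSpace (V ⊗[ℝ] W) := moduleTopology ℝ (V ⊗[ℝ] W)
    let _ : TopologicalSpace (Dual ℝ (V ⊗[ℝ] W)) := moduleTopology ℝ _
    have : IsModuleTopology ℝ (V ⊗[ℝ] W) := ⟨rfl⟩
    have : IsModuleTopology ℝ (Dual ℝ (V ⊗[ℝ] W)) := ⟨rfl⟩
    obtain ⟨K, h1, h2, h3, h4⟩ := minTensor_base A B
    exact mem_interior_dual_of_compact_base h1 (fun k hk => by rw [h3 k hk]; exact one_pos) h4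

/-! ### Locally constrained measurements

Here `A` and `B` are the local theories and `AB` is their composite. -/

/-- Local operations: coarse grainings of product measurements `(e_i ⊗ f_j)_{i,j}`. -/
def measurementsLO (A : GPT V) (B : GPT W) : Set (FunctionalFamily (V ⊗[ℝ] W)) :=
  {E | ∃ e ∈ A.measurements, ∃ f ∈ B.measurements,
    IsCoarseGraining (fun p : Fin e.1 × Fin f.1 => prodFunctional (e.2 p.1) (f.2 p.2)) E.2}

/-- One-way LOCC: coarse grainings of families `(e_i ⊗ f_j^{(i)})_{i,j}`, where for each `i` the
family `(f_j^{(i)})_j` is a measurement on the second system. -/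
def measurementsOneWay (A : GPT V) (B : GPT W) : Set (FunctionalFamily (V ⊗[ℝ] W)) :=
  {E | ∃ e ∈ A.measurements, ∃ (k : ℕ) (f : Fin e.1 → Fin k → Dual ℝ W),
    (∀ i, (⟨k, f i⟩ : FunctionalFamily W) ∈ B.measurements) ∧
    IsCoarseGraining (fun p : Fin e.1 × Fin k => prodFunctional (e.2 p.1) (f p.1 p.2)) E.2}

/-- Separable measurements: all elements lie in the minimal tensor product of the dual cones. -/
def measurementsSEP (A : GPT V) (B : GPT W) (AB : GPT (V ⊗[ℝ] W)) :
    Set (FunctionalFamily (V ⊗[ℝ] W)) :=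
  {E | E ∈ AB.measurements ∧ ∀ i, ∃ Z ∈ PointedCone.minTensorProduct A.dualCone B.dualCone,
    E.2 i = TensorProduct.dualDistrib ℝ V W Z}

/-- An instrument on the first system: a finite family of linear maps `φ_i` on `V` that are
completely positive, i.e. `φ_i ⊗ id` preserves the cone of the composite, and whose sum preserves the
unit effect. -/
def IsInstrumentLeft (A : GPT V) (AB : GPT (V ⊗[ℝ] W)) {ι : Type*} [Fintype ι]
    (φ : ι → V →ₗ[ℝ] V) : Prop :=
  (∀ i, ∀ X ∈ AB.cone, TensorProduct.map (φ i) LinearMap.id X ∈ AB.cone) ∧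
    ∑ i, A.unit ∘ₗ φ i = A.unit

/-- An instrument on the second system. -/
def IsInstrumentRight (B : GPT W) (AB : GPT (V ⊗[ℝ] W)) {ι : Type*} [Fintype ι]
    (ψ : ι → W →ₗ[ℝ] W) : Prop :=
  (∀ i, ∀ X ∈ AB.cone, TensorProduct.map LinearMap.id (ψ i) X ∈ AB.cone) ∧
    ∑ i, B.unit ∘ₗ ψ i = B.unit

/-- One-way local instruments: one of the parties applies an instrument and broadcasts the outcome
`i`, and then the other party applies a channel (an instrument with a single outcome) that depends on
`i`. -/
def IsOneWayLocal (A : GPT V) (B : GPT W) (AB : GPT (V ⊗[ℝ] W)) {ι : Type*} [Fintype ι]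
    (Φ : ι → V ⊗[ℝ] W →ₗ[ℝ] V ⊗[ℝ] W) : Prop :=
  ∃ (φ : ι → V →ₗ[ℝ] V) (ψ : ι → W →ₗ[ℝ] W), (∀ i, Φ i = TensorProduct.map (φ i) (ψ i)) ∧
    ((IsInstrumentLeft A AB φ ∧ ∀ i, IsInstrumentRight B AB fun _ : Unit => ψ i) ∨
      (IsInstrumentRight B AB ψ ∧ ∀ i, IsInstrumentLeft A AB fun _ : Unit => φ i))

/-- Finite families of linear maps on the composite system. -/
abbrev MapFamily (V W : Type*) [AddCommGroup V] [Module ℝ V] [AddCommGroup W] [Module ℝ W] :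
    Type _ :=
  Σ k : ℕ, (Fin k → V ⊗[ℝ] W →ₗ[ℝ] V ⊗[ℝ] W)

/-- `Φ'` is LOCC linked to `Φ`: it is a coarse graining of the instrument that consists in applying
`Φ` first, and then a one-way local instrument (whose acting party may vary) chosen according to the
outcome of `Φ`. -/
def IsLOCCLinked (A : GPT V) (B : GPT W) (AB : GPT (V ⊗[ℝ] W)) (Φ' Φ : MapFamily V W) : Prop :=
  ∃ F : Fin Φ.1 → MapFamily V W, (∀ i, IsOneWayLocal A B AB (F i).2) ∧
    IsCoarseGraining (fun p : Σ i, Fin (F i).1 => (F p.1).2 p.2 ∘ₗ Φ.2 p.1) Φ'.2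

/-- Instruments that are implemented by LOCC protocols with finitely many rounds. -/
inductive IsFiniteLOCC (A : GPT V) (B : GPT W) (AB : GPT (V ⊗[ℝ] W)) : MapFamily V W → Prop
  | one (Ψ Φ : MapFamily V W) (hΨ : IsOneWayLocal A B AB Ψ.2) (hΦ : IsCoarseGraining Ψ.2 Φ.2) :
      IsFiniteLOCC A B AB Φ
  | link (Φ Φ' : MapFamily V W) (hΦ : IsFiniteLOCC A B AB Φ) (hΦ' : IsLOCCLinked A B AB Φ' Φ) :
      IsFiniteLOCC A B AB Φ'

/-- LOCC instruments: there is a sequence of instruments implemented by protocols with finitely many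
rounds, each of them LOCC linked to the preceding one, with coarse grainings that converge to the
given instrument. (The space of linear maps being finite-dimensional, convergence is expressed through
matrix elements.) -/
def IsLOCC (A : GPT V) (B : GPT W) (AB : GPT (V ⊗[ℝ] W)) (Φ : MapFamily V W) : Prop :=
  ∃ (J : ℕ → MapFamily V W) (J' : ℕ → Fin Φ.1 → V ⊗[ℝ] W →ₗ[ℝ] V ⊗[ℝ] W),
    (∀ r, IsFiniteLOCC A B AB (J r)) ∧ (∀ r, IsLOCCLinked A B AB (J (r + 1)) (J r)) ∧
    (∀ r, IsCoarseGraining (J r).2 (J' r)) ∧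
    ∀ i X (f : Dual ℝ (V ⊗[ℝ] W)),
      Filter.Tendsto (fun r => f (J' r i X)) Filter.atTop (𝓝 (f (Φ.2 i X)))

/-- LOCC measurements: the families `(Φ_i^*(u))_i` for LOCC instruments `(Φ_i)_i`. -/
def measurementsLOCC (A : GPT V) (B : GPT W) (AB : GPT (V ⊗[ℝ] W)) :
    Set (FunctionalFamily (V ⊗[ℝ] W)) :=
  {E | ∃ Φ : Fin E.1 → V ⊗[ℝ] W →ₗ[ℝ] V ⊗[ℝ] W, IsLOCC A B AB ⟨E.1, Φ⟩ ∧
    ∀ i, E.2 i = AB.unit ∘ₗ Φ i}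

/-- Labels of the four locally constrained sets of measurements. -/
inductive LocalClass
  | LO
  | LOCCOneWay
  | LOCC
  | SEP

/-- The locally constrained set of measurements with a given label. -/
def LocalClass.measurements (c : LocalClass) (A : GPT V) (B : GPT W) (AB : GPT (V ⊗[ℝ] W)) :
    Set (FunctionalFamily (V ⊗[ℝ] W)) :=
  match c with
  | .LO => measurementsLO A B
  | .LOCCOneWay => measurementsOneWay A B
  | .LOCC => measurementsLOCC A B AB
  | .SEP => measurementsSEP A B AB

end Bipartite

/-! ### Centrally symmetric models and the cubic models -/

section CentrallySymmetric

/-- The centrally symmetric model on `ℝ ⊕ E` defined by a norm on `E`: the cone consists of the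
`(x₀, x)` with `‖x‖ ≤ x₀`, and the unit effect is `(x₀, x) ↦ x₀`. -/
noncomputable def centrallySymmetric (E : Type*) [NormedAddCommGroup E] [NormedSpace ℝ E]
    [FiniteDimensional ℝ E] : GPT (ℝ × E) where
  cone :=
    { carrier := {x | ‖x.2‖ ≤ x.1}
      add_mem' := fun {x y} hx hy => (norm_add_le x.2 y.2).trans (add_le_add hx hy)
      zero_mem' := by simp
      smul_mem' := fun c x hx => by
        have hx' : ‖x.2‖ ≤ x.1 := hx
        have h : ‖(c : ℝ) • x.2‖ ≤ (c : ℝ) * x.1 := by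
          rw [norm_smul, Real.norm_of_nonneg c.2]
          exact mul_le_mul_of_nonneg_left hx' c.2
        exact h }
  unit := LinearMap.fst ℝ ℝ E
  isClosed_cone := by
    have : IsModuleTopology ℝ (ℝ × E) := isModuleTopologyOfFiniteDimensional
    rw [← eq_moduleTopology ℝ (ℝ × E)]
    exact isClosed_le (f := fun x : ℝ × E => ‖x.2‖) (g := fun x => x.1)
      (by fun_prop) (by fun_prop)
  salient := by
    intro x hx hx'
    have h1 : ‖x.2‖ ≤ x.1 := hx
    have h2 : ‖-x.2‖ ≤ -x.1 := hx'
    rw [norm_neg] at h2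
    have h3 := norm_nonneg x.2
    have h4 : x.2 = 0 := norm_eq_zero.1 (by linarith)
    exact Prod.ext (by simp; linarith) h4
  generating := by
    rw [eq_top_iff]
    intro x _
    have h : x = (((‖x.2‖, x.2) : ℝ × E)) + (x.1 - ‖x.2‖) • ((1, 0) : ℝ × E) := by
      ext <;> simp
    rw [h]
    refine Submodule.add_mem _ (Submodule.subset_span ?_)
      (Submodule.smul_mem _ _ (Submodule.subset_span ?_))
    · exact le_refl ‖x.2‖
    · change ‖(0 : E)‖ ≤ 1
      simp
  unit_mem_interior := by
    have : IsModuleTopology ℝ (ℝ × E) := isModuleTopologyOfFiniteDimensional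
    let _ : TopologicalSpace (Dual ℝ (ℝ × E)) := moduleTopology ℝ _
    have : IsModuleTopology ℝ (Dual ℝ (ℝ × E)) := ⟨rfl⟩
    have : ProperSpace E := FiniteDimensional.proper_real E
    refine mem_interior_dual_of_compact_base (K := {(1 : ℝ)} ×ˢ Metric.closedBall (0 : E) 1)
      (isCompact_singleton.prod (isCompact_closedBall _ _)) ?_ ?_
    · rintro ⟨a, v⟩ ⟨rfl, -⟩
      simp
    · rintro ⟨t, v⟩ hx
      have hv : ‖v‖ ≤ t := hx
      have ht : 0 ≤ t := (norm_nonneg v).trans hv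
      refine ⟨t, ht, ?_⟩
      rcases ht.eq_or_lt with rfl | ht
      · exact Or.inl ⟨rfl, by simpa using hv⟩
      · refine Or.inr ⟨(1, t⁻¹ • v), ⟨rfl, ?_⟩, ?_⟩
        · rw [mem_closedBall_zero_iff, norm_smul, norm_inv, Real.norm_of_nonneg ht.le,
            inv_mul_eq_div]
          exact div_le_one_of_le₀ hv ht.le
        · ext <;> simp [ht.ne']

/-- The cubic model `G_n`: its state space is the `n`-dimensional hypercube. The norm of `Fin n → ℝ`
is the maximum norm. -/
noncomputable def cubic (n : ℕ) : GPT (ℝ × (Fin n → ℝ)) := centrallySymmetric (Fin n → ℝ)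

variable {E F : Type*} [NormedAddCommGroup E] [NormedSpace ℝ E]
  [NormedAddCommGroup F] [NormedSpace ℝ F]

/-- The embedding `M ↦ M̂ = 0 ⊕ 0 ⊕ 0 ⊕ M` of `E ⊗ F` into `(ℝ ⊕ E) ⊗ (ℝ ⊕ F)`. -/
noncomputable def hat : E ⊗[ℝ] F →ₗ[ℝ] (ℝ × E) ⊗[ℝ] (ℝ × F) :=
  TensorProduct.map (LinearMap.inr ℝ ℝ E) (LinearMap.inr ℝ ℝ F)

/-- The ratios `‖M̂‖ / ‖M̂‖_𝓜` for `M ≠ 0`. The restricted data hiding ratio against `𝓜` is the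
greatest of them. -/
def restrictedRatios [FiniteDimensional ℝ E] [FiniteDimensional ℝ F]
    (AB : GPT ((ℝ × E) ⊗[ℝ] (ℝ × F))) (𝓜 : Set (FunctionalFamily ((ℝ × E) ⊗[ℝ] (ℝ × F)))) :
    Set ℝ :=
  {r | ∃ M : E ⊗[ℝ] F, M ≠ 0 ∧ r = AB.baseNorm (hat M) / distNorm 𝓜 (hat M)}

/-- The injective norm on `E ⊗ F`. -/
noncomputable def injectiveNorm (M : E ⊗[ℝ] F) : ℝ :=
  sSup {r | ∃ (f : StrongDual ℝ E) (g : StrongDual ℝ F), ‖f‖ ≤ 1 ∧ ‖g‖ ≤ 1 ∧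
    r = prodFunctional f.toLinearMap g.toLinearMap M}

/-- The projective norm on `E ⊗ F`. -/
noncomputable def projectiveNorm (M : E ⊗[ℝ] F) : ℝ :=
  sInf {r | ∃ (k : ℕ) (x : Fin k → E) (y : Fin k → F), M = ∑ i, x i ⊗ₜ[ℝ] y i ∧
    r = ∑ i, ‖x i‖ * ‖y i‖}

end CentrallySymmetric

end DataHiding

namespace DataHiding

/-! ### Khintchine's inequality with the optimal constant in `L¹` -/

section Khintchine

/-! On the vectors `hat M` every norm in sight becomes a classical tensor norm. A functional lying
between minus and plus the unit of the minimal tensor product restricts to a bilinear form of norm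
at most one on `E × F`, and every such form arises in this way; by Hahn-Banach the base norm of `hat
M` is therefore the projective norm of `M`. For the locally constrained norms, all four classes lie
between LO and the measurements whose elements are nonnegative on the maximal tensor product of the
cones. Products of binary measurements already reach the injective norm, and no measurement positive
on the maximal cone exceeds it, because `injectiveNorm M • (1,0) ⊗ (1,0) ± hat M` lies in that cone.
So the four restricted ratios are one and the same quotient (`baseNorm_hat`, `distNorm_hat`), and
the maximum exists by compactness.

For the maximum norms the quotient is estimated from both sides. Above: a bilinear form of norm one
on `ℓ_∞ × ℓ_∞` attains the projective norm, the injective norm dominates each entry of `M`, and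
Littlewood's argument bounds the sum of the absolute values of the entries of the form by `√(2 min n
m)` (`sum_abs_le_of_signs`). It rests on Khintchine's inequality between `L¹` and `L²` with constant
`√2`, obtained here from a spectral gap on the discrete cube. Below: the Hartley matrix has entries
of modulus at most `√2`, hence injective norm at most `√2`, while pairing it with itself and using
the orthogonality of its rows gives projective norm at least `√(min n m)`.

For the unrestricted ratios, the unit ball of the base norm consists of the vectors `p ρ - (1 - p)
σ`, so each quotient of projective by injective norm is itself an efficiency; this is the lower
bound. For the upper bound Littlewood's argument is repeated on the full spaces `ℝ ⊕ ℝⁿ` and `ℝ ⊕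
ℝᵐ`: sign combinations of the standard basis are states up to sign, and products of coordinates are
controlled by LO (`distNorm_measurements_le_LO`). The price is only `min n m + 1` in place of `min n
m`. -/

theorem exists_sign_mul_eq_abs (r : ℝ) : ∃ t : ℤˣ, |r| = ((t : ℤ) : ℝ) * r := by
  rcases abs_choice r with h | h
  · exact ⟨1, by simp [h]⟩
  · exact ⟨-1, by simp [h]⟩

theorem sum_cons_signs {n : ℕ} (f : (Fin (n + 1) → ℤˣ) → ℝ) :
    ∑ s, f s = ∑ t : Fin n → ℤˣ, f (Fin.cons 1 t) + ∑ t : Fin n → ℤˣ, f (Fin.cons (-1) t) := by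
  rw [← (Fin.consEquiv fun _ => ℤˣ).sum_comp, Fintype.sum_prod_type, UnitsInt.univ,
    Finset.sum_pair (by decide)]
  rfl

/-- The Dirichlet form of the random walk on the discrete cube. -/
def cubeEnergy {n : ℕ} (f : (Fin n → ℤˣ) → ℝ) : ℝ :=
  ∑ s, ∑ i, f s * (f s - f (Function.update s i (-s i)))

/-- Splitting off the first coordinate leaves the energies of the two facets; the two endpoints of
an edge in the first direction together contribute a square. -/
theorem cubeEnergy_succ {n : ℕ} (f : (Fin (n + 1) → ℤˣ) → ℝ) :
    cubeEnergy f = cubeEnergy (fun t => f (Fin.cons 1 t)) + cubeEnergy (fun t => f (Fin.cons (-1) t))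
      + ∑ t : Fin n → ℤˣ, (f (Fin.cons 1 t) - f (Fin.cons (-1) t)) ^ 2 := by
  simp only [cubeEnergy, sum_cons_signs, Fin.sum_univ_succ, Fin.cons_zero, Fin.cons_succ,
    Fin.update_cons_zero, ← Fin.cons_update, neg_neg, ← Finset.sum_add_distrib]
  exact Finset.sum_congr rfl fun t _ => by rw [Finset.sum_add_distrib]; ring

theorem cubeEnergy_parallelogram {n : ℕ} (f g : (Fin n → ℤˣ) → ℝ) :
    cubeEnergy f + cubeEnergy g = 2 * cubeEnergy (fun s => (f s + g s) / 2)
      + 2 * cubeEnergy (fun s => (f s - g s) / 2) := by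
  simp only [cubeEnergy, Finset.mul_sum, ← Finset.sum_add_distrib]
  exact Finset.sum_congr rfl fun s _ => Finset.sum_congr rfl fun i _ => by ring

theorem cubeEnergy_nonneg : ∀ {n : ℕ} (f : (Fin n → ℤˣ) → ℝ), 0 ≤ cubeEnergy f
  | 0, f => by simp [cubeEnergy]
  | n + 1, f => by
    rw [cubeEnergy_succ]
    have := cubeEnergy_nonneg fun t => f (Fin.cons 1 t)
    have := cubeEnergy_nonneg fun t => f (Fin.cons (-1) t)
    positivity

theorem sum_even_part {n : ℕ} (f : (Fin (n + 1) → ℤˣ) → ℝ) :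
    ∑ s, f s = 2 * ∑ t : Fin n → ℤˣ, (f (Fin.cons 1 t) + f (Fin.cons (-1) t)) / 2 := by
  rw [sum_cons_signs, ← Finset.sum_add_distrib, Finset.mul_sum]
  exact Finset.sum_congr rfl fun t _ => by ring

theorem sum_sq_even_odd {n : ℕ} (f : (Fin (n + 1) → ℤˣ) → ℝ) :
    ∑ s, f s ^ 2 = 2 * ∑ t : Fin n → ℤˣ, ((f (Fin.cons 1 t) + f (Fin.cons (-1) t)) / 2) ^ 2
      + 2 * ∑ t : Fin n → ℤˣ, ((f (Fin.cons 1 t) - f (Fin.cons (-1) t)) / 2) ^ 2 := by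
  rw [sum_cons_signs]
  simp only [Finset.mul_sum, ← Finset.sum_add_distrib]
  exact Finset.sum_congr rfl fun t _ => by ring

/-- In Walsh terms, the parts of `f` even and odd in the first coordinate decouple; the last sum is
the extra eigenvalue 2 that the factor `s 0` gives to the odd part. -/
theorem cubeEnergy_even_odd {n : ℕ} (f : (Fin (n + 1) → ℤˣ) → ℝ) :
    cubeEnergy f = 2 * cubeEnergy (fun t => (f (Fin.cons 1 t) + f (Fin.cons (-1) t)) / 2)
      + 2 * cubeEnergy (fun t => (f (Fin.cons 1 t) - f (Fin.cons (-1) t)) / 2)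
      + 4 * ∑ t : Fin n → ℤˣ, ((f (Fin.cons 1 t) - f (Fin.cons (-1) t)) / 2) ^ 2 := by
  rw [cubeEnergy_succ, cubeEnergy_parallelogram, Finset.mul_sum]
  congr 1
  exact Finset.sum_congr rfl fun t _ => by ring

/-- The Poincaré inequality on the discrete cube. -/
theorem poincare_cube : ∀ {n : ℕ} (f : (Fin n → ℤˣ) → ℝ),
    2 * (2 ^ n * ∑ s, f s ^ 2 - (∑ s, f s) ^ 2) ≤ 2 ^ n * cubeEnergy f
  | 0, f => by simp [cubeEnergy]
  | n + 1, f => by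
    rw [sum_sq_even_odd, sum_even_part f, cubeEnergy_even_odd]
    have h1 := poincare_cube fun t => (f (Fin.cons 1 t) + f (Fin.cons (-1) t)) / 2
    have h2 := mul_nonneg (pow_nonneg (zero_le_two (α := ℝ)) n)
      (cubeEnergy_nonneg fun t => (f (Fin.cons 1 t) - f (Fin.cons (-1) t)) / 2)
    rw [pow_succ]
    linarith

/-- The Poincaré inequality on the discrete cube, with a better constant beyond the linear part of
the function. -/
theorem poincare_cube_level_two : ∀ {n : ℕ} (f : (Fin n → ℤˣ) → ℝ),
    4 * (2 ^ n * ∑ s, f s ^ 2 - (∑ s, f s) ^ 2) - 2 * ∑ i, (∑ s, ((s i : ℤ) : ℝ) * f s) ^ 2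
      ≤ 2 ^ n * cubeEnergy f
  | 0, f => by simp [cubeEnergy]
  | n + 1, f => by
    -- The odd part is multiplied by `s 0`, which raises all its levels by one, so the plain
    -- Poincaré inequality suffices for it; its mean is the first linear coefficient of `f`.
    have h1 := poincare_cube_level_two fun t => (f (Fin.cons 1 t) + f (Fin.cons (-1) t)) / 2
    have h2 := poincare_cube fun t => (f (Fin.cons 1 t) - f (Fin.cons (-1) t)) / 2
    have h3 : ∑ s : Fin (n + 1) → ℤˣ, ((s 0 : ℤ) : ℝ) * f s
        = 2 * ∑ t : Fin n → ℤˣ, (f (Fin.cons 1 t) - f (Fin.cons (-1) t)) / 2 := by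
      rw [sum_even_part]
      congr 1
      exact Finset.sum_congr rfl fun t _ => by simp; ring
    have h4 : ∀ i : Fin n, ∑ s : Fin (n + 1) → ℤˣ, ((s i.succ : ℤ) : ℝ) * f s
        = 2 * ∑ t : Fin n → ℤˣ, ((t i : ℤ) : ℝ) * ((f (Fin.cons 1 t) + f (Fin.cons (-1) t)) / 2) := by
      intro i
      rw [sum_even_part]
      congr 1
      exact Finset.sum_congr rfl fun t _ => by simp; ring
    rw [sum_sq_even_odd, sum_even_part f, cubeEnergy_even_odd, Fin.sum_univ_succ, h3]
    simp only [h4, mul_pow, ← Finset.mul_sum]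
    rw [pow_succ]
    linarith

theorem sum_signs_sq : ∀ {n : ℕ} (b : Fin n → ℝ),
    ∑ s : Fin n → ℤˣ, (∑ i, b i * ((s i : ℤ) : ℝ)) ^ 2 = 2 ^ n * ∑ i, b i ^ 2
  | 0, b => by simp
  | n + 1, b => by
    have h := sum_signs_sq fun i => b (Fin.succ i)
    have hc : ∑ _t : Fin n → ℤˣ, b 0 ^ 2 = 2 ^ n * b 0 ^ 2 := by simp
    simp only [sum_cons_signs, Fin.sum_univ_succ, Fin.cons_zero, Fin.cons_succ]
    rw [pow_succ, mul_add, mul_right_comm, ← hc, mul_right_comm, ← h, Finset.sum_mul, Finset.sum_mul,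
      ← Finset.sum_add_distrib, ← Finset.sum_add_distrib]
    exact Finset.sum_congr rfl fun t _ => by push_cast; ring

/-- The argument of Latała and Oleszkiewicz. The function `f = |∑ b i s i|` is even, so its linear
Walsh coefficients vanish and the spectral gap doubles from 2 to 4. The triangle inequality bounds
the energy of `f` by twice its square norm. Together these give `‖f‖₂² ≤ 2 ‖f‖₁²` for the uniform
probability; the powers of 2 undo the normalisation. -/
theorem khintchine_fin {n : ℕ} (b : Fin n → ℝ) :
    (2 ^ n) ^ 2 * ∑ i, b i ^ 2 ≤ 2 * (∑ s : Fin n → ℤˣ, |∑ i, b i * ((s i : ℤ) : ℝ)|) ^ 2 := by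
  set f : (Fin n → ℤˣ) → ℝ := fun s => |∑ i, b i * ((s i : ℤ) : ℝ)| with hf
  have hsq : ∑ s, f s ^ 2 = 2 ^ n * ∑ i, b i ^ 2 := by
    simp only [hf, sq_abs, sum_signs_sq]
  have hodd : ∀ i, ∑ s, ((s i : ℤ) : ℝ) * f s = 0 := by
    intro i
    have h : ∑ s, ((s i : ℤ) : ℝ) * f s = -∑ s, ((s i : ℤ) : ℝ) * f s := by
      rw [← Finset.sum_neg_distrib, ← Equiv.sum_comp (Equiv.neg (Fin n → ℤˣ))]
      exact Finset.sum_congr rfl fun s _ => by simp [hf, Finset.sum_neg_distrib]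
    linarith
  have hen : cubeEnergy f ≤ 2 * ∑ s, f s ^ 2 := by
    rw [cubeEnergy, Finset.mul_sum]
    refine Finset.sum_le_sum fun s _ => ?_
    have h1 : ∀ i, ∑ j, b j * ((Function.update s i (-s i) j : ℤ) : ℝ)
        = ∑ j, b j * ((s j : ℤ) : ℝ) - 2 * (b i * ((s i : ℤ) : ℝ)) := by
      intro i
      have h : ∀ j, b j * ((Function.update s i (-s i) j : ℤ) : ℝ)
          = b j * ((s j : ℤ) : ℝ) - if j = i then 2 * (b i * ((s i : ℤ) : ℝ)) else 0 := by
        intro j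
        rcases eq_or_ne j i with rfl | hj
        · simp; ring
        · simp [hj]
      simp [h, Finset.sum_sub_distrib]
    -- Summed over all single flips, the linear form `∑ b j s j` is reproduced with factor `n - 2`,
    -- since each term changes sign exactly once.
    have h2 : ((n : ℝ) - 2) * f s ≤ ∑ i, f (Function.update s i (-s i)) := by
      calc ((n : ℝ) - 2) * f s ≤ |(n : ℝ) - 2| * f s :=
            mul_le_mul_of_nonneg_right (le_abs_self _) (abs_nonneg _)
        _ = |∑ i, ∑ j, b j * ((Function.update s i (-s i) j : ℤ) : ℝ)| := by
            simp only [h1, hf, ← abs_mul, Finset.sum_sub_distrib, ← Finset.mul_sum]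
            congr 1
            simp; ring
        _ ≤ _ := Finset.abs_sum_le_sum_abs _ _
    rw [← Finset.mul_sum, Finset.sum_sub_distrib]
    have h3 := mul_le_mul_of_nonneg_left h2 (abs_nonneg _ : 0 ≤ f s)
    simp only [Finset.sum_const, Finset.card_univ, Fintype.card_fin, nsmul_eq_mul]
    nlinarith
  have hp := poincare_cube_level_two f
  simp only [hodd] at hp
  have h2 := mul_le_mul_of_nonneg_left hen (pow_nonneg (zero_le_two (α := ℝ)) n)
  rw [hsq] at hp h2
  norm_num at hp
  nlinarith

/-- Khintchine followed by Cauchy-Schwarz, which contributes the square root of the number of terms.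
-/
theorem khintchine_sum_abs {ι : Type*} [Fintype ι] [DecidableEq ι] (b : ι → ℝ) :
    2 ^ Fintype.card ι * ∑ i, |b i|
      ≤ √(2 * Fintype.card ι) * ∑ s : ι → ℤˣ, |∑ i, b i * ((s i : ℤ) : ℝ)| := by
  have e := Fintype.equivFin ι
  have h0 := khintchine_fin (b ∘ e.symm)
  have h1 : ∑ s : Fin (Fintype.card ι) → ℤˣ, |∑ i, (b ∘ e.symm) i * ((s i : ℤ) : ℝ)|
      = ∑ s : ι → ℤˣ, |∑ i, b i * ((s i : ℤ) : ℝ)| := by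
    rw [← (e.arrowCongr (Equiv.refl ℤˣ)).sum_comp]
    refine Finset.sum_congr rfl fun s _ => ?_
    rw [← e.sum_comp]
    simp
  have h2 : ∑ i, (b ∘ e.symm) i ^ 2 = ∑ i, b i ^ 2 := by
    rw [← e.sum_comp]; simp
  rw [h1, h2] at h0
  have h3 : (∑ i, |b i|) ^ 2 ≤ Fintype.card ι * ∑ i, b i ^ 2 := by
    simpa using sq_sum_le_card_mul_sum_sq (s := Finset.univ) (f := fun i => |b i|)
  have hS : 0 ≤ ∑ s : ι → ℤˣ, |∑ i, b i * ((s i : ℤ) : ℝ)| :=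
    Finset.sum_nonneg fun _ _ => abs_nonneg _
  refine abs_le_of_sq_le_sq' ?_ (by positivity) |>.2
  rw [mul_pow, mul_pow, Real.sq_sqrt (by positivity)]
  calc _ ≤ ((2 : ℝ) ^ Fintype.card ι) ^ 2 * (Fintype.card ι * ∑ i, b i ^ 2) := by gcongr
    _ = Fintype.card ι * (((2 : ℝ) ^ Fintype.card ι) ^ 2 * ∑ i, b i ^ 2) := by ring
    _ ≤ Fintype.card ι * (2 * (∑ s : ι → ℤˣ, |∑ i, b i * ((s i : ℤ) : ℝ)|) ^ 2) := by gcongr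
    _ = _ := by ring

/-- A bilinear form of norm at most one on `ℓ_∞ × ℓ_∞` has entries of sum at most
`√(2 n)`, where `n` is the number of its rows. -/
theorem sum_abs_le_of_signs {ι κ : Type*} [Fintype ι] [DecidableEq ι] [Fintype κ]
    (B : ι → κ → ℝ)
    (hB : ∀ (s : ι → ℤˣ) (t : κ → ℤˣ), ∑ i, ∑ j, ((s i : ℤ) : ℝ) * ((t j : ℤ) : ℝ) * B i j ≤ 1) :
    ∑ i, ∑ j, |B i j| ≤ √(2 * Fintype.card ι) := by
  have h1 : ∀ s : ι → ℤˣ, ∑ j, |∑ i, B i j * ((s i : ℤ) : ℝ)| ≤ 1 := by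
    intro s
    choose t ht using fun j => exists_sign_mul_eq_abs (∑ i, B i j * ((s i : ℤ) : ℝ))
    refine le_trans (le_of_eq ?_) (hB s t)
    rw [Finset.sum_comm]
    refine Finset.sum_congr rfl fun j _ => ?_
    rw [ht, Finset.mul_sum]
    exact Finset.sum_congr rfl fun i _ => by ring
  -- Khintchine is applied to each column; the sum over columns is then moved inside the average
  -- over row signs, where the hypothesis bounds it by one.
  have h2 : ∑ j, ∑ s : ι → ℤˣ, |∑ i, B i j * ((s i : ℤ) : ℝ)| ≤ 2 ^ Fintype.card ι := by
    rw [Finset.sum_comm]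
    simpa using Finset.sum_le_card_nsmul Finset.univ _ 1 fun s _ => h1 s
  have h3 := Finset.sum_le_sum fun j (_ : j ∈ Finset.univ) => khintchine_sum_abs fun i => B i j
  rw [← Finset.mul_sum, ← Finset.mul_sum, Finset.sum_comm] at h3
  have h4 : (0 : ℝ) < 2 ^ Fintype.card ι := by positivity
  refine le_of_mul_le_mul_left (h3.trans ?_) h4
  rw [mul_comm]
  gcongr

/-- Duality between the sum of the entries of `F` and the largest coordinate of `z`. Stated for
arbitrary bases because it serves twice: on `ℝⁿ ⊗ ℝᵐ` for the projective norm and on the full space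
of the two cubic models. -/
theorem dual_le_of_coords {ι κ V W : Type*} [Fintype ι] [DecidableEq ι] [Fintype κ] [DecidableEq κ]
    [AddCommGroup V] [Module ℝ V] [AddCommGroup W] [Module ℝ W]
    (b : Basis ι ℝ V) (d : Basis κ ℝ W) (F : Dual ℝ (V ⊗[ℝ] W))
    (hF : ∀ (s : ι → ℤˣ) (t : κ → ℤˣ),
      F ((∑ i, ((s i : ℤ) : ℝ) • b i) ⊗ₜ[ℝ] (∑ j, ((t j : ℤ) : ℝ) • d j)) ≤ 1)
    (z : V ⊗[ℝ] W) {c : ℝ} (hz : ∀ i j, |prodFunctional (b.coord i) (d.coord j) z| ≤ c) (hc : 0 ≤ c) :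
    F z ≤ √(2 * (min (Fintype.card ι) (Fintype.card κ) : ℕ)) * c := by
  have hB : ∀ (s : ι → ℤˣ) (t : κ → ℤˣ),
      ∑ i, ∑ j, ((s i : ℤ) : ℝ) * ((t j : ℤ) : ℝ) * F (b i ⊗ₜ[ℝ] d j) ≤ 1 := by
    intro s t
    refine le_trans (le_of_eq ?_) (hF s t)
    simp only [TensorProduct.sum_tmul, TensorProduct.tmul_sum, TensorProduct.smul_tmul_smul, map_sum,
      map_smul, smul_eq_mul]
    exact Finset.sum_comm
  have h1 : ∑ i, ∑ j, |F (b i ⊗ₜ[ℝ] d j)| ≤ √(2 * (min (Fintype.card ι) (Fintype.card κ) : ℕ)) := by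
    -- Rows and columns play symmetric roles, so the signs are averaged on the smaller side.
    rcases min_choice (Fintype.card ι) (Fintype.card κ) with h | h <;> rw [h]
    · exact sum_abs_le_of_signs (fun i j => F (b i ⊗ₜ[ℝ] d j)) hB
    · rw [Finset.sum_comm]
      refine sum_abs_le_of_signs (fun j i => F (b i ⊗ₜ[ℝ] d j)) fun t s => ?_
      rw [Finset.sum_comm]
      simpa only [mul_comm (((t _ : ℤˣ) : ℤ) : ℝ)] using hB s t
  have h2 : ∀ z, F z = ∑ i, ∑ j, prodFunctional (b.coord i) (d.coord j) z * F (b i ⊗ₜ[ℝ] d j) := by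
    intro z
    induction z using TensorProduct.induction_on with
    | zero => simp
    | add x y hx hy => simp only [map_add, hx, hy, add_mul, Finset.sum_add_distrib]
    | tmul x y =>
      conv_lhs => rw [← b.sum_repr x, ← d.sum_repr y]
      simp only [TensorProduct.sum_tmul, TensorProduct.tmul_sum, TensorProduct.smul_tmul_smul, map_sum,
        map_smul, smul_eq_mul]
      rw [Finset.sum_comm]
      simp [prodFunctional]
  rw [h2]
  calc _ ≤ ∑ i, ∑ j, c * |F (b i ⊗ₜ[ℝ] d j)| := by
        refine Finset.sum_le_sum fun i _ => Finset.sum_le_sum fun j _ => ?_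
        refine (le_abs_self _).trans ?_
        rw [abs_mul]
        exact mul_le_mul_of_nonneg_right (hz i j) (abs_nonneg _)
    _ ≤ _ := by
        simp only [← Finset.mul_sum]
        rw [mul_comm]
        exact mul_le_mul_of_nonneg_right h1 hc

end Khintchine

/-! ### Seminorms on finite-dimensional spaces -/

section Seminorms

variable {V : Type*} [AddCommGroup V] [Module ℝ V] [FiniteDimensional ℝ V]
  [TopologicalSpace V] [IsModuleTopology ℝ V]

/-- Expansion in a basis bounds `p` by a continuous function vanishing at 0, and a seminorm
continuous at 0 is continuous. -/
theorem continuous_seminorm (p : Seminorm ℝ V) : Continuous p := by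
  have : IsTopologicalAddGroup V := IsModuleTopology.topologicalAddGroup ℝ V
  let b := finBasis ℝ V
  refine Seminorm.continuous_of_continuousAt_zero ?_
  have hb : ∀ x, p x ≤ ∑ i, |b.coord i x| * p (b i) := by
    intro x
    conv_lhs => rw [← b.sum_repr x]
    refine (Finset.le_sum_of_subadditive p (map_zero p).le (map_add_le_add p) _ _).trans ?_
    exact Finset.sum_le_sum fun i _ => by simp [map_smul_eq_mul]
  have hc : Continuous fun x => ∑ i, |b.coord i x| * p (b i) :=
    continuous_finsetSum _ fun i _ =>
      ((IsModuleTopology.continuous_of_linearMap (b.coord i)).abs).mul continuous_const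
  have h0 := hc.tendsto 0
  simp only [map_zero, abs_zero, zero_mul, Finset.sum_const_zero] at h0
  rw [ContinuousAt, map_zero]
  exact tendsto_of_tendsto_of_tendsto_of_le_of_le tendsto_const_nhds h0
    (fun x => apply_nonneg p x) hb

/-- A continuous linear equivalence with a coordinate space. -/
noncomputable def coordEquiv (V : Type*) [AddCommGroup V] [Module ℝ V] [FiniteDimensional ℝ V]
    [TopologicalSpace V] [IsModuleTopology ℝ V] : V ≃L[ℝ] (Fin (finrank ℝ V) → ℝ) :=
  have : IsTopologicalAddGroup V := IsModuleTopology.topologicalAddGroup ℝ V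
  have : ContinuousSMul ℝ V := IsModuleTopology.toContinuousSMul ℝ V
  { (finBasis ℝ V).equivFun with
    continuous_toFun := IsModuleTopology.continuous_of_linearMap (finBasis ℝ V).equivFun.toLinearMap
    continuous_invFun :=
      IsModuleTopology.continuous_of_linearMap (finBasis ℝ V).equivFun.symm.toLinearMap }

theorem exists_max_ratio {V : Type*} [AddCommGroup V] [Module ℝ V] [FiniteDimensional ℝ V]
    [Nontrivial V] (p q : Seminorm ℝ V) (hq : ∀ x, x ≠ 0 → 0 < q x) :
    ∃ x, x ≠ 0 ∧ ∀ y, y ≠ 0 → p y / q y ≤ p x / q x := by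
  let _ : TopologicalSpace V := moduleTopology ℝ V
  have : IsModuleTopology ℝ V := ⟨rfl⟩
  let e := coordEquiv V
  have : Nontrivial (Fin (finrank ℝ V) → ℝ) := e.symm.toEquiv.nontrivial
  -- The quotient is homogeneous of degree zero, so it is enough to maximise over the image of a
  -- coordinate unit sphere.
  have hK : IsCompact (e.symm '' Metric.sphere 0 1) :=
    (isCompact_sphere (0 : Fin (finrank ℝ V) → ℝ) 1).image e.symm.continuous
  have hne : ∀ x ∈ e.symm '' Metric.sphere 0 1, x ≠ 0 := by
    rintro _ ⟨v, hv, rfl⟩ h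
    have : v = 0 := by simpa using h
    simp [this] at hv
  obtain ⟨x, hx, hmax⟩ := hK.exists_isMaxOn
    ((NormedSpace.sphere_nonempty (x := (0 : Fin (finrank ℝ V) → ℝ)).2 zero_le_one).image _)
    (f := fun x => p x / q x)
    ((continuous_seminorm p).continuousOn.div (continuous_seminorm q).continuousOn
      fun x hx => (hq x (hne x hx)).ne')
  refine ⟨x, hne x hx, fun y hy => ?_⟩
  have hey : e y ≠ 0 := by simpa using hy
  have hpos : 0 < ‖e y‖ := norm_pos_iff.2 hey
  have hmem : ‖e y‖⁻¹ • y ∈ e.symm '' Metric.sphere 0 1 :=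
    ⟨‖e y‖⁻¹ • e y, by simp [norm_smul, hpos.ne'], by simp⟩
  have h := hmax hmem
  have h2 : p (‖e y‖⁻¹ • y) / q (‖e y‖⁻¹ • y) = p y / q y := by
    rw [map_smul_eq_mul, map_smul_eq_mul, mul_div_mul_left]
    simp [hpos.ne']
  exact h2 ▸ h

end Seminorms

/-! ### Distinguishability norms and the base norm -/

section General

variable {V : Type*} [AddCommGroup V] [Module ℝ V] [FiniteDimensional ℝ V]

namespace GPT

theorem unit_mem_dualCone (A : GPT V) : A.unit ∈ A.dualCone :=
  @interior_subset _ (moduleTopology ℝ (Dual ℝ V)) _ _ A.unit_mem_interior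

theorem compact_base (A : GPT V) [TopologicalSpace V] [IsModuleTopology ℝ V] :
    IsCompact A.states ∧ ∀ a ∈ A.cone, A.unit a ≤ 0 → a = 0 := by
  let _ : TopologicalSpace (Dual ℝ V) := moduleTopology ℝ _
  have : IsModuleTopology ℝ (Dual ℝ V) := ⟨rfl⟩
  refine isCompact_base ?_ A.unit_mem_interior
  rw [eq_moduleTopology ℝ V]
  exact A.isClosed_cone

theorem exists_state_of_mem_cone (A : GPT V) {x : V} (hx : x ∈ A.cone) (h0 : x ≠ 0) :
    ∃ ρ ∈ A.states, 0 < A.unit x ∧ x = A.unit x • ρ := by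
  let _ : TopologicalSpace V := moduleTopology ℝ V
  have : IsModuleTopology ℝ V := ⟨rfl⟩
  have hpos : 0 < A.unit x := by
    by_contra h
    exact h0 (A.compact_base.2 x hx (not_lt.1 h))
  refine ⟨(A.unit x)⁻¹ • x, ⟨A.cone.smul_mem (inv_nonneg.2 hpos.le) hx, ?_⟩, hpos, ?_⟩
  · simp [hpos.ne']
  · simp [hpos.ne']

theorem mem_dualCone_of_states (A : GPT V) {f : Dual ℝ V} (hf : ∀ ρ ∈ A.states, 0 ≤ f ρ) :
    f ∈ A.dualCone := by
  intro x hx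
  rcases eq_or_ne x 0 with rfl | h0
  · simp
  obtain ⟨ρ, hρ, hpos, h⟩ := A.exists_state_of_mem_cone hx h0
  change 0 ≤ f x
  rw [h, map_smul]
  exact mul_nonneg hpos.le (hf ρ hρ)

theorem sum_abs_of_mem_cone (A : GPT V) {e : FunctionalFamily V} (he : e ∈ A.measurements) {x : V}
    (hx : x ∈ A.cone) : ∑ i, |e.2 i x| = A.unit x := by
  rw [← he.2, LinearMap.sum_apply]
  exact Finset.sum_congr rfl fun i _ => abs_of_nonneg ((he.1 i).1 hx)

/-- On the cone the sum equals the unit effect, whatever the measurement, and the cone spans. The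
uniform bound makes the suprema in `distNorm` genuine, not default values. -/
theorem exists_bound_sum_abs (A : GPT V) (x : V) :
    ∃ c : ℝ, ∀ e ∈ A.measurements, ∑ i, |e.2 i x| ≤ c := by
  have hx : x ∈ Submodule.span ℝ (A.cone : Set V) := A.generating ▸ Submodule.mem_top
  induction hx using Submodule.span_induction with
  | mem x hx => exact ⟨A.unit x, fun e he => (A.sum_abs_of_mem_cone he hx).le⟩
  | zero => exact ⟨0, fun e _ => by simp⟩
  | add x y _ _ hx hy =>
    obtain ⟨c, hc⟩ := hx
    obtain ⟨d, hd⟩ := hy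
    refine ⟨c + d, fun e he => le_trans ?_ (add_le_add (hc e he) (hd e he))⟩
    rw [← Finset.sum_add_distrib]
    exact Finset.sum_le_sum fun i _ => by rw [map_add]; exact abs_add_le _ _
  | smul a x _ hx =>
    obtain ⟨c, hc⟩ := hx
    refine ⟨|a| * c, fun e he => le_trans (le_of_eq ?_)
      (mul_le_mul_of_nonneg_left (hc e he) (abs_nonneg a))⟩
    rw [Finset.mul_sum]
    exact Finset.sum_congr rfl fun i _ => by rw [map_smul, smul_eq_mul, abs_mul]

variable {A : GPT V} {𝓜 𝓜' : Set (FunctionalFamily V)}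

theorem bddAbove_distNorm (h : 𝓜 ⊆ A.measurements) (x : V) :
    BddAbove {r | ∃ e ∈ 𝓜, r = ∑ i, |e.2 i x|} := by
  obtain ⟨c, hc⟩ := A.exists_bound_sum_abs x
  refine ⟨c, ?_⟩
  rintro _ ⟨e, he, rfl⟩
  exact hc e (h he)

theorem le_distNorm (h : 𝓜 ⊆ A.measurements) {e : FunctionalFamily V} (he : e ∈ 𝓜) (x : V) :
    ∑ i, |e.2 i x| ≤ distNorm 𝓜 x :=
  le_csSup (bddAbove_distNorm h x) ⟨e, he, rfl⟩

theorem distNorm_le {V : Type*} [AddCommGroup V] [Module ℝ V] {𝓜 : Set (FunctionalFamily V)}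
    (h0 : 𝓜.Nonempty) {x : V} {c : ℝ} (h : ∀ e ∈ 𝓜, ∑ i, |e.2 i x| ≤ c) :
    distNorm 𝓜 x ≤ c := by
  obtain ⟨e, he⟩ := h0
  refine csSup_le ⟨_, e, he, rfl⟩ ?_
  rintro _ ⟨e, he, rfl⟩
  exact h e he

theorem distNorm_mono (h : 𝓜 ⊆ 𝓜') (h' : 𝓜' ⊆ A.measurements) (h0 : 𝓜.Nonempty) (x : V) :
    distNorm 𝓜 x ≤ distNorm 𝓜' x :=
  distNorm_le h0 fun _ he => le_distNorm h' (h he) x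

/-- The distinguishability norm as a seminorm. -/
noncomputable def distSeminorm (h : 𝓜 ⊆ A.measurements) (h0 : 𝓜.Nonempty) : Seminorm ℝ V :=
  Seminorm.ofSMulLE (distNorm 𝓜)
    (le_antisymm (distNorm_le h0 fun e _ => by simp)
      (Real.sSup_nonneg (by
        rintro _ ⟨e, -, rfl⟩
        exact Finset.sum_nonneg fun _ _ => abs_nonneg _)))
    (fun x y => distNorm_le h0 fun e he => by
      refine le_trans ?_ (add_le_add (le_distNorm h he x) (le_distNorm h he y))
      rw [← Finset.sum_add_distrib]
      exact Finset.sum_le_sum fun i _ => by rw [map_add]; exact abs_add_le _ _)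
    (fun a x => distNorm_le h0 fun e he => by
      refine le_trans (le_of_eq ?_) (mul_le_mul_of_nonneg_left (le_distNorm h he x) (norm_nonneg a))
      rw [Finset.mul_sum]
      exact Finset.sum_congr rfl fun i _ => by
        rw [map_smul, smul_eq_mul, abs_mul, Real.norm_eq_abs])

theorem continuous_distNorm [TopologicalSpace V] [IsModuleTopology ℝ V] (h : 𝓜 ⊆ A.measurements)
    (h0 : 𝓜.Nonempty) : Continuous (distNorm 𝓜) :=
  continuous_seminorm (distSeminorm h h0)

/-- The binary measurement with expectation value `f`. -/
noncomputable def binary (A : GPT V) (f : Dual ℝ V) : FunctionalFamily V :=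
  ⟨2, ![(2⁻¹ : ℝ) • (A.unit + f), (2⁻¹ : ℝ) • (A.unit - f)]⟩

theorem binary_mem (A : GPT V) {f : Dual ℝ V} (h1 : A.unit - f ∈ A.dualCone)
    (h2 : f + A.unit ∈ A.dualCone) : A.binary f ∈ A.measurements := by
  have hp : (2⁻¹ : ℝ) • (A.unit + f) ∈ A.dualCone :=
    A.dualCone.smul_mem (by norm_num : (0 : ℝ) ≤ 2⁻¹) (by rwa [add_comm])
  have hm : (2⁻¹ : ℝ) • (A.unit - f) ∈ A.dualCone :=
    A.dualCone.smul_mem (by norm_num : (0 : ℝ) ≤ 2⁻¹) h1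
  have e1 : A.unit - (2⁻¹ : ℝ) • (A.unit + f) = (2⁻¹ : ℝ) • (A.unit - f) := by module
  have e2 : A.unit - (2⁻¹ : ℝ) • (A.unit - f) = (2⁻¹ : ℝ) • (A.unit + f) := by module
  constructor
  · intro i
    fin_cases i
    · exact ⟨hp, (e1 ▸ hm : A.unit - (2⁻¹ : ℝ) • (A.unit + f) ∈ A.dualCone)⟩
    · exact ⟨hm, (e2 ▸ hp : A.unit - (2⁻¹ : ℝ) • (A.unit - f) ∈ A.dualCone)⟩
  · refine (Fin.sum_univ_two _).trans ?_
    change (2⁻¹ : ℝ) • (A.unit + f) + (2⁻¹ : ℝ) • (A.unit - f) = A.unit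
    module

theorem apply_le_distNorm_measurements (A : GPT V) {f : Dual ℝ V} (h1 : A.unit - f ∈ A.dualCone)
    (h2 : f + A.unit ∈ A.dualCone) (x : V) : f x ≤ distNorm A.measurements x := by
  refine le_trans ?_ (le_distNorm subset_rfl (A.binary_mem h1 h2) x)
  have h3 := le_abs_self ((2⁻¹ : ℝ) * (A.unit x + f x))
  have h4 := neg_abs_le ((2⁻¹ : ℝ) * (A.unit x - f x))
  refine le_trans ?_ (Fin.sum_univ_two _).ge
  change f x ≤ |(2⁻¹ : ℝ) * (A.unit x + f x)| + |(2⁻¹ : ℝ) * (A.unit x - f x)|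
  linarith

theorem measurements_nonempty (A : GPT V) : A.measurements.Nonempty :=
  ⟨_, A.binary_mem (f := 0) (by simpa using A.unit_mem_dualCone)
    (by simpa using A.unit_mem_dualCone)⟩

theorem bddAbove_baseNorm (A : GPT V) (x : V) :
    BddAbove {r | ∃ f : Dual ℝ V, A.unit - f ∈ A.dualCone ∧ f + A.unit ∈ A.dualCone ∧ r = f x} := by
  refine ⟨distNorm A.measurements x, ?_⟩
  rintro _ ⟨f, h1, h2, rfl⟩
  exact A.apply_le_distNorm_measurements h1 h2 x

/-- The distinguishability norm for all measurements is given by two-outcome measurements. -/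
theorem exists_eq_sum_abs (A : GPT V) {e : FunctionalFamily V} (he : e ∈ A.measurements) (x : V) :
    ∃ f : Dual ℝ V, A.unit - f ∈ A.dualCone ∧ f + A.unit ∈ A.dualCone ∧ ∑ i, |e.2 i x| = f x := by
  have hs : ∀ r : ℝ, ∃ t : ℝ, |t| ≤ 1 ∧ |r| = t * r := by
    intro r
    rcases abs_choice r with h | h
    · exact ⟨1, by simp, by simp [h]⟩
    · exact ⟨-1, by simp, by simp [h]⟩
  choose t ht1 ht using fun i => hs (e.2 i x)
  refine ⟨∑ i, t i • e.2 i, ?_, ?_, by simp [ht]⟩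
  · rw [← he.2, ← Finset.sum_sub_distrib]
    refine Submodule.sum_mem _ fun i _ => ?_
    rw [show e.2 i - t i • e.2 i = (1 - t i) • e.2 i by module]
    exact A.dualCone.smul_mem (sub_nonneg.2 (abs_le.1 (ht1 i)).2) (he.1 i).1
  · rw [← he.2, ← Finset.sum_add_distrib]
    refine Submodule.sum_mem _ fun i _ => ?_
    rw [show t i • e.2 i + e.2 i = (1 + t i) • e.2 i by module]
    exact A.dualCone.smul_mem (by linarith [(abs_le.1 (ht1 i)).1] : (0 : ℝ) ≤ 1 + t i) (he.1 i).1

/-- The vectors `p ρ - (1 - p) σ` for states `ρ`, `σ` and probabilities `p`. -/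
def mixtures (A : GPT V) : Set V :=
  {z | ∃ ρ ∈ A.states, ∃ σ ∈ A.states, ∃ p ∈ Set.Icc (0 : ℝ) 1, z = p • ρ - (1 - p) • σ}

theorem isCompact_mixtures (A : GPT V) [TopologicalSpace V] [IsModuleTopology ℝ V] :
    IsCompact A.mixtures := by
  have : IsTopologicalAddGroup V := IsModuleTopology.topologicalAddGroup ℝ V
  have : ContinuousSMul ℝ V := IsModuleTopology.toContinuousSMul ℝ V
  have h := ((A.compact_base.1.prod A.compact_base.1).prod
    (isCompact_Icc (a := (0 : ℝ)) (b := 1))).image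
    (f := fun q : (V × V) × ℝ => q.2 • q.1.1 - (1 - q.2) • q.1.2) (by fun_prop)
  convert h using 1
  ext z
  constructor
  · rintro ⟨ρ, hρ, σ, hσ, p, hp, rfl⟩
    exact ⟨((ρ, σ), p), ⟨⟨hρ, hσ⟩, hp⟩, rfl⟩
  · rintro ⟨⟨⟨ρ, σ⟩, p⟩, ⟨⟨hρ, hσ⟩, hp⟩, rfl⟩
    exact ⟨ρ, hρ, σ, hσ, p, hp, rfl⟩

theorem convex_states (A : GPT V) : Convex ℝ A.states :=
  A.cone.convex.inter (convex_hyperplane A.unit.isLinear 1)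

theorem convex_mixtures (A : GPT V) : Convex ℝ A.mixtures := by
  suffices h : A.mixtures = convexJoin ℝ A.states (-A.states) from
    h ▸ A.convex_states.convexJoin A.convex_states.neg
  ext z
  rw [mem_convexJoin]
  constructor
  · rintro ⟨ρ, hρ, σ, hσ, p, hp, rfl⟩
    exact ⟨ρ, hρ, -σ, by simpa using hσ, p, 1 - p, hp.1, sub_nonneg.2 hp.2, by ring, by simp [sub_eq_add_neg]⟩
  · rintro ⟨ρ, hρ, σ, hσ, p, q, hp, hq, hpq, rfl⟩
    refine ⟨ρ, hρ, -σ, hσ, p, ⟨hp, by linarith⟩, ?_⟩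
    obtain rfl : q = 1 - p := by linarith
    simp

theorem distNorm_le_one_of_mem_mixtures (A : GPT V) {z : V} (hz : z ∈ A.mixtures) :
    distNorm A.measurements z ≤ 1 := by
  obtain ⟨ρ, hρ, σ, hσ, p, hp, rfl⟩ := hz
  refine distNorm_le A.measurements_nonempty fun e he => ?_
  calc ∑ i, |e.2 i (p • ρ - (1 - p) • σ)| ≤ ∑ i, (p * |e.2 i ρ| + (1 - p) * |e.2 i σ|) := by
        refine Finset.sum_le_sum fun i _ => ?_
        rw [map_sub, map_smul, map_smul, smul_eq_mul, smul_eq_mul]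
        refine (abs_sub _ _).trans (le_of_eq ?_)
        rw [abs_mul, abs_mul, abs_of_nonneg hp.1, abs_of_nonneg (sub_nonneg.2 hp.2)]
    _ = 1 := by
        rw [Finset.sum_add_distrib, ← Finset.mul_sum, ← Finset.mul_sum,
          A.sum_abs_of_mem_cone he hρ.1, A.sum_abs_of_mem_cone he hσ.1, hρ.2, hσ.2]
        ring

/-- The unit ball of the base norm consists of the vectors `p ρ - (1 - p) σ`. -/
theorem mem_mixtures_of_forall_le_one (A : GPT V) (h0 : A.states.Nonempty) {z : V}
    (hz : ∀ f : Dual ℝ V, A.unit - f ∈ A.dualCone → f + A.unit ∈ A.dualCone → f z ≤ 1) :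
    z ∈ A.mixtures := by
  let _ : TopologicalSpace V := moduleTopology ℝ V
  have : IsModuleTopology ℝ V := ⟨rfl⟩
  have : IsTopologicalAddGroup V := IsModuleTopology.topologicalAddGroup ℝ V
  have : ContinuousSMul ℝ V := IsModuleTopology.toContinuousSMul ℝ V
  have : T2Space V := t2Space_of_moduleTopology
  have : LocallyConvexSpace ℝ V := 
    (coordEquiv V).toHomeomorph.isInducing.locallyConvexSpace (f := (coordEquiv V).toLinearMap)
  by_contra hn
  -- The mixtures contain `ρ` (for `p = 1`) and `-ρ` (for `p = 0`), so a separating functional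
  -- divided by the separating level is admissible in the base norm, yet exceeds one at `z`.
  obtain ⟨f, s, hs, hsz⟩ := geometric_hahn_banach_closed_point A.convex_mixtures
    A.isCompact_mixtures.isClosed hn
  have hp : ∀ ρ ∈ A.states, f ρ < s := fun ρ hρ => hs ρ ⟨ρ, hρ, ρ, hρ, 1, by simp, by simp⟩
  have hm : ∀ ρ ∈ A.states, -f ρ < s := fun ρ hρ => by
    simpa using hs (-ρ) ⟨ρ, hρ, ρ, hρ, 0, by simp, by simp⟩
  obtain ⟨ρ₀, hρ₀⟩ := h0
  have hs0 : 0 < s := by linarith [hp ρ₀ hρ₀, hm ρ₀ hρ₀]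
  have h := hz (s⁻¹ • f.toLinearMap) (A.mem_dualCone_of_states fun ρ hρ => ?_)
    (A.mem_dualCone_of_states fun ρ hρ => ?_)
  · have h' : s⁻¹ * f z ≤ 1 := h
    rw [inv_mul_le_iff₀ hs0] at h'
    linarith
  · have h1 : s⁻¹ * f ρ ≤ 1 := by
      rw [inv_mul_le_iff₀ hs0]; linarith [hp ρ hρ]
    simpa [hρ.2] using h1
  · have h1 : s⁻¹ * -f ρ ≤ 1 := by
      rw [inv_mul_le_iff₀ hs0]; linarith [hm ρ hρ]
    simp [hρ.2]
    linarith

/-- If the locally constrained norm dominates a multiple of the unconstrained one, then the data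
hiding ratio exists. -/
theorem exists_isGreatest_efficiencies (A : GPT V) (hA : A.states.Nonempty)
    (h : 𝓜 ⊆ A.measurements) (h0 : 𝓜.Nonempty) {c : ℝ}
    (hc : ∀ z, distNorm A.measurements z ≤ c * distNorm 𝓜 z) :
    ∃ R, IsGreatest (dataHidingEfficiencies A 𝓜) R ∧ R ≤ c := by
  let _ : TopologicalSpace V := moduleTopology ℝ V
  have : IsModuleTopology ℝ V := ⟨rfl⟩
  -- Zero error for all measurements means norm one, and an efficiency `R` means constrained norm `1
  -- / R`. The largest `R` thus corresponds to the minimum of a continuous function on this compact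
  -- set.
  have hK : IsCompact (A.mixtures ∩ {z | distNorm A.measurements z = 1}) :=
    A.isCompact_mixtures.inter_right (isClosed_eq
      (continuous_distNorm subset_rfl A.measurements_nonempty) continuous_const)
  have hne : (A.mixtures ∩ {z | distNorm A.measurements z = 1}).Nonempty := by
    obtain ⟨ρ, hρ⟩ := hA
    have hm : ρ ∈ A.mixtures := ⟨ρ, hρ, ρ, hρ, 1, by simp, by simp⟩
    refine ⟨ρ, hm, le_antisymm (A.distNorm_le_one_of_mem_mixtures hm) ?_⟩
    have := A.apply_le_distNorm_measurements (f := A.unit) (by simp)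
      (A.dualCone.add_mem A.unit_mem_dualCone A.unit_mem_dualCone) ρ
    rwa [hρ.2] at this
  obtain ⟨z, ⟨hz, hz1⟩, hmin⟩ := hK.exists_isMinOn hne (continuous_distNorm h h0).continuousOn
  have hle : distNorm 𝓜 z ≤ 1 := hz1 ▸ distNorm_mono h subset_rfl h0 z
  have hcz := hc z
  have hge : 0 ≤ distNorm 𝓜 z := apply_nonneg (distSeminorm h h0) z
  rw [hz1] at hcz
  -- Only here and in the final bound is the comparison with `c` used: it excludes a vanishing
  -- minimum, that is, perfect data hiding.
  have hpos : 0 < distNorm 𝓜 z := hge.lt_of_ne fun h' => by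
    rw [← h', mul_zero] at hcz
    linarith
  refine ⟨1 / distNorm 𝓜 z, ⟨⟨?_, ?_⟩, ?_⟩, ?_⟩
  · rwa [le_div_iff₀ hpos, one_mul]
  · obtain ⟨ρ, hρ, σ, hσ, p, hp, rfl⟩ := hz
    refine ⟨ρ, hρ, σ, hσ, p, hp, ?_, ?_⟩
    · rw [errorProb, hz1]; norm_num
    · rw [errorProb, one_div_one_div]; ring
  · rintro R ⟨hR, ρ, hρ, σ, hσ, p, hp, h1, h2⟩
    have h3 : distNorm 𝓜 z ≤ distNorm 𝓜 (p • ρ - (1 - p) • σ) := by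
      refine hmin ⟨⟨ρ, hρ, σ, hσ, p, hp, rfl⟩, ?_⟩
      simp only [errorProb] at h1
      change distNorm A.measurements _ = 1
      linarith
    have h4 : distNorm 𝓜 (p • ρ - (1 - p) • σ) = 1 / R := by
      simp only [errorProb] at h2
      linarith
    rw [h4] at h3
    rw [le_div_iff₀ hpos]
    calc R * distNorm 𝓜 z ≤ R * (1 / R) := by gcongr
      _ = 1 := by field_simp
  · rwa [div_le_iff₀ hpos]

end GPT

end General

/-! ### Relations between the classes of locally constrained measurements -/

section CoarseGraining

variable {W ι κ : Type*} [AddCommMonoid W] [Fintype ι]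

theorem IsCoarseGraining.refl (E : ι → W) : IsCoarseGraining E E := by
  classical
  refine ⟨id, Function.surjective_id, fun j => ?_⟩
  simp [Finset.sum_filter]

theorem IsCoarseGraining.sum_eq [Fintype κ] {E : ι → W} {E' : κ → W} (h : IsCoarseGraining E E') :
    ∑ j, E' j = ∑ i, E i := by
  classical
  obtain ⟨g, -, hg⟩ := h
  simp only [hg]
  convert Finset.sum_fiberwise Finset.univ g E

theorem IsCoarseGraining.mem {S : AddSubmonoid W} {E : ι → W} {E' : κ → W}
    (h : IsCoarseGraining E E') (hE : ∀ i, E i ∈ S) (j : κ) : E' j ∈ S := by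
  obtain ⟨g, -, hg⟩ := h
  rw [hg]
  exact S.sum_mem fun i _ => hE i

end CoarseGraining

/-! ### Calculus of product functionals. -/

section ProdFunctional

variable {V W : Type*} [AddCommGroup V] [Module ℝ V] [AddCommGroup W] [Module ℝ W]

@[simp]
theorem prodFunctional_tmul (e : Dual ℝ V) (f : Dual ℝ W) (v : V) (w : W) :
    prodFunctional e f (v ⊗ₜ[ℝ] w) = e v * f w := by
  simp [prodFunctional]

theorem prodFunctional_map {V' W' : Type*} [AddCommGroup V'] [Module ℝ V'] [AddCommGroup W']
    [Module ℝ W'] (e : Dual ℝ V') (f : Dual ℝ W') (φ : V →ₗ[ℝ] V') (ψ : W →ₗ[ℝ] W') :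
    prodFunctional e f ∘ₗ TensorProduct.map φ ψ = prodFunctional (e ∘ₗ φ) (f ∘ₗ ψ) :=
  TensorProduct.ext' fun v w => by simp

theorem sum_prodFunctional_left {ι : Type*} [Fintype ι] (e : ι → Dual ℝ V) (f : Dual ℝ W) :
    ∑ i, prodFunctional (e i) f = prodFunctional (∑ i, e i) f := by
  simp [prodFunctional, TensorProduct.sum_tmul]

theorem sum_prodFunctional_right {ι : Type*} [Fintype ι] (e : Dual ℝ V) (f : ι → Dual ℝ W) :
    ∑ i, prodFunctional e (f i) = prodFunctional e (∑ i, f i) := by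
  simp [prodFunctional, TensorProduct.tmul_sum]

end ProdFunctional

/-! ### The four classes lie between LO and the measurements positive on the maximal tensor product.
-/

section Classes

variable {V W : Type*} [AddCommGroup V] [Module ℝ V] [FiniteDimensional ℝ V]
  [AddCommGroup W] [Module ℝ W] [FiniteDimensional ℝ W] {A : GPT V} {B : GPT W}

/-- The functionals on `V ⊗ W` that are nonnegative on the maximal tensor product of the cones. -/
noncomputable def maxPositive (A : GPT V) (B : GPT W) : PointedCone ℝ (Dual ℝ (V ⊗[ℝ] W)) :=
  PointedCone.dual (Dual.eval ℝ (V ⊗[ℝ] W))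
    (PointedCone.maxTensorProduct A.cone B.cone : Set (V ⊗[ℝ] W))

theorem mem_maxTensor {X : V ⊗[ℝ] W} : X ∈ PointedCone.maxTensorProduct A.cone B.cone ↔
    ∀ e ∈ A.dualCone, ∀ f ∈ B.dualCone, 0 ≤ prodFunctional e f X :=
  PointedCone.mem_maxTensorProduct

theorem prodFunctional_mem_maxPositive {e : Dual ℝ V} {f : Dual ℝ W} (he : e ∈ A.dualCone)
    (hf : f ∈ B.dualCone) : prodFunctional e f ∈ maxPositive A B :=
  fun _ hX => mem_maxTensor.1 hX e he f hf

/-- The measurements whose elements are nonnegative on the maximal tensor product of the cones. -/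
def maxPositiveMeasurements (A : GPT V) (B : GPT W) : Set (FunctionalFamily (V ⊗[ℝ] W)) :=
  {E | (∀ i, E.2 i ∈ maxPositive A B) ∧ ∑ i, E.2 i = prodFunctional A.unit B.unit}

theorem maxPositive_le_dualCone : maxPositive A B ≤ (A.minTensor B).dualCone :=
  fun _ hE _ hX => hE (PointedCone.minTensorProduct_le_maxTensorProduct _ _ hX)

theorem maxPositiveMeasurements_subset :
    maxPositiveMeasurements A B ⊆ (A.minTensor B).measurements := by
  classical
  rintro E ⟨h1, h2⟩
  refine ⟨fun i => ⟨maxPositive_le_dualCone (h1 i), ?_⟩, h2⟩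
  change prodFunctional A.unit B.unit - E.2 i ∈ _
  rw [← h2, ← Finset.add_sum_erase _ _ (Finset.mem_univ i), add_sub_cancel_left]
  exact Submodule.sum_mem _ fun j _ => maxPositive_le_dualCone (h1 j)

theorem measurementsLO_subset_oneWay : measurementsLO A B ⊆ measurementsOneWay A B := by
  rintro E ⟨e, he, f, hf, h⟩
  exact ⟨e, he, f.1, fun _ => f.2, fun _ => hf, h⟩

theorem measurementsSEP_subset :
    measurementsSEP A B (A.minTensor B) ⊆ maxPositiveMeasurements A B := by
  rintro E ⟨h1, h2⟩
  refine ⟨fun i => ?_, h1.2⟩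
  obtain ⟨Z, hZ, h⟩ := h2 i
  rw [h]
  clear h
  unfold PointedCone.minTensorProduct PointedCone.hull at hZ
  induction hZ using Submodule.span_induction with
  | mem x hx =>
    obtain ⟨e, he, f, hf, rfl⟩ := hx
    exact prodFunctional_mem_maxPositive he hf
  | zero => simp
  | add x y _ _ hx hy =>
    rw [map_add]
    exact add_mem hx hy
  | smul c x _ hx =>
    have : TensorProduct.dualDistrib ℝ V W (c • x) = c • TensorProduct.dualDistrib ℝ V W x :=
      map_smul (TensorProduct.dualDistrib ℝ V W) (c : ℝ) x
    rw [this]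
    exact Submodule.smul_mem _ c hx

/-- Positivity and normalisation of families of maps, with respect to the maximal tensor product. -/
def IsMaxInstrument (A : GPT V) (B : GPT W) {ι : Type*} [Fintype ι]
    (Φ : ι → V ⊗[ℝ] W →ₗ[ℝ] V ⊗[ℝ] W) : Prop :=
  (∀ i, ∀ X ∈ PointedCone.maxTensorProduct A.cone B.cone,
    Φ i X ∈ PointedCone.maxTensorProduct A.cone B.cone) ∧
  ∑ i, prodFunctional A.unit B.unit ∘ₗ Φ i = prodFunctional A.unit B.unit

theorem IsMaxInstrument.coarseGraining {ι κ : Type*} [Fintype ι] [Fintype κ]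
    {Φ : ι → V ⊗[ℝ] W →ₗ[ℝ] V ⊗[ℝ] W} {Φ' : κ → V ⊗[ℝ] W →ₗ[ℝ] V ⊗[ℝ] W}
    (h : IsMaxInstrument A B Φ) (hg : IsCoarseGraining Φ Φ') : IsMaxInstrument A B Φ' := by
  constructor
  · intro j X hX
    obtain ⟨g, -, hg⟩ := hg
    rw [hg, LinearMap.sum_apply]
    exact Submodule.sum_mem _ fun i _ => h.1 i X hX
  · refine TensorProduct.ext' fun v w => ?_
    have h2 := congrArg (fun T : Dual ℝ (V ⊗[ℝ] W) => T (v ⊗ₜ w)) h.2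
    have h3 := congrArg (fun T : V ⊗[ℝ] W →ₗ[ℝ] V ⊗[ℝ] W =>
      prodFunctional A.unit B.unit (T (v ⊗ₜ w))) hg.sum_eq
    simp only [LinearMap.sum_apply, LinearMap.comp_apply, map_sum] at h2 h3
    simpa [h3] using h2

/-- Complete positivity is tested on `a ⊗ b` with `b` a state of the other party, and read off with
that party's unit effect. -/
theorem IsInstrumentLeft.comp_mem_dualCone (hB : B.states.Nonempty) {ι : Type*} [Fintype ι]
    {φ : ι → V →ₗ[ℝ] V} (h : IsInstrumentLeft A (A.minTensor B) φ) (i : ι) {e : Dual ℝ V}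
    (he : e ∈ A.dualCone) : e ∘ₗ φ i ∈ A.dualCone := by
  obtain ⟨b, hb, hb1⟩ := hB
  intro a ha
  have h1 := maxPositive_le_dualCone (prodFunctional_mem_maxPositive he B.unit_mem_dualCone)
    (h.1 i (a ⊗ₜ b) (PointedCone.tmul_mem_minTensorProduct ha hb))
  simpa [hb1] using h1

theorem IsInstrumentRight.comp_mem_dualCone (hA : A.states.Nonempty) {ι : Type*} [Fintype ι]
    {ψ : ι → W →ₗ[ℝ] W} (h : IsInstrumentRight B (A.minTensor B) ψ) (i : ι) {f : Dual ℝ W}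
    (hf : f ∈ B.dualCone) : f ∘ₗ ψ i ∈ B.dualCone := by
  obtain ⟨a, ha, ha1⟩ := hA
  intro b hb
  have h1 := maxPositive_le_dualCone (prodFunctional_mem_maxPositive A.unit_mem_dualCone hf)
    (h.1 i (a ⊗ₜ b) (PointedCone.tmul_mem_minTensorProduct ha hb))
  simpa [ha1] using h1

/-- The adjoints of local positive maps preserve the local dual cones, hence map product effects to
product effects, and the maximal cone is defined by product effects alone. -/
theorem isMaxInstrument_of_oneWayLocal (hA : A.states.Nonempty) (hB : B.states.Nonempty)
    {ι : Type*} [Fintype ι] {Φ : ι → V ⊗[ℝ] W →ₗ[ℝ] V ⊗[ℝ] W}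
    (h : IsOneWayLocal A B (A.minTensor B) Φ) : IsMaxInstrument A B Φ := by
  obtain ⟨φ, ψ, hΦ, h⟩ := h
  have hpos : (∀ i, ∀ e ∈ A.dualCone, e ∘ₗ φ i ∈ A.dualCone) ∧
      ∀ i, ∀ f ∈ B.dualCone, f ∘ₗ ψ i ∈ B.dualCone := by
    rcases h with ⟨h1, h2⟩ | ⟨h1, h2⟩
    · exact ⟨fun i e he => h1.comp_mem_dualCone hB i he,
        fun i f hf => (h2 i).comp_mem_dualCone hA () hf⟩
    · exact ⟨fun i e he => (h2 i).comp_mem_dualCone hB () he,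
        fun i f hf => h1.comp_mem_dualCone hA i hf⟩
  constructor
  · intro i X hX
    rw [mem_maxTensor]
    intro e he f hf
    rw [hΦ, ← LinearMap.comp_apply, prodFunctional_map]
    exact mem_maxTensor.1 hX _ (hpos.1 i e he) _ (hpos.2 i f hf)
  · simp only [hΦ, prodFunctional_map]
    rcases h with ⟨h1, h2⟩ | ⟨h1, h2⟩
    · have h3 : ∀ i, B.unit ∘ₗ ψ i = B.unit := fun i => by simpa using (h2 i).2
      simp only [h3, sum_prodFunctional_left, h1.2]
    · have h3 : ∀ i, A.unit ∘ₗ φ i = A.unit := fun i => by simpa using (h2 i).2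
      simp only [h3, sum_prodFunctional_right, h1.2]

theorem IsMaxInstrument.linked (hA : A.states.Nonempty) (hB : B.states.Nonempty)
    {Φ Φ' : MapFamily V W} (h : IsMaxInstrument A B Φ.2)
    (hl : IsLOCCLinked A B (A.minTensor B) Φ' Φ) : IsMaxInstrument A B Φ'.2 := by
  obtain ⟨F, hF, hg⟩ := hl
  have hF' := fun i => isMaxInstrument_of_oneWayLocal hA hB (hF i)
  refine IsMaxInstrument.coarseGraining ⟨fun p X hX => (hF' p.1).1 p.2 _ (h.1 p.1 X hX), ?_⟩ hg
  rw [Fintype.sum_sigma]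
  refine Eq.trans ?_ h.2
  refine Finset.sum_congr rfl fun i _ => ?_
  refine LinearMap.ext fun X => ?_
  have h2 := congrArg (fun T : Dual ℝ (V ⊗[ℝ] W) => T (Φ.2 i X)) (hF' i).2
  simpa using h2

theorem IsFiniteLOCC.isMaxInstrument (hA : A.states.Nonempty) (hB : B.states.Nonempty)
    {Φ : MapFamily V W} (h : IsFiniteLOCC A B (A.minTensor B) Φ) : IsMaxInstrument A B Φ.2 := by
  induction h with
  | one Ψ Φ hΨ hΦ => exact (isMaxInstrument_of_oneWayLocal hA hB hΨ).coarseGraining hΦ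
  | link Φ Φ' _ hl ih => exact ih.linked hA hB hl

theorem measurementsLOCC_subset (hA : A.states.Nonempty) (hB : B.states.Nonempty) :
    measurementsLOCC A B (A.minTensor B) ⊆ maxPositiveMeasurements A B := by
  rintro ⟨k, E⟩ ⟨Φ, ⟨J, J', h1, -, h2, h3⟩, h4⟩
  have hJ := fun r => ((h1 r).isMaxInstrument hA hB).coarseGraining (h2 r)
  have hu := prodFunctional_mem_maxPositive A.unit_mem_dualCone B.unit_mem_dualCone
  -- Positivity on the maximal cone and normalisation hold for every finite-round approximation, and
  -- both are closed conditions, so they pass to the limit.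
  have hE : ∀ i X, Filter.Tendsto (fun r => prodFunctional A.unit B.unit (J' r i X)) Filter.atTop
      (𝓝 (E i X)) := by
    intro i X
    have := h4 i
    simp only at this
    rw [this]
    exact h3 i X _
  constructor
  · intro i X hX
    exact ge_of_tendsto' (hE i X) fun r => hu ((hJ r).1 i X hX)
  · refine LinearMap.ext fun X => ?_
    have h5 := tendsto_finsetSum Finset.univ fun i _ => hE i X
    have h6 : ∀ r, ∑ i, prodFunctional A.unit B.unit (J' r i X) = prodFunctional A.unit B.unit X := by
      intro r
      have := congrArg (fun T : Dual ℝ (V ⊗[ℝ] W) => T X) (hJ r).2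
      simpa only [LinearMap.sum_apply, LinearMap.comp_apply] using this
    simp only [h6] at h5
    rw [LinearMap.sum_apply]
    exact tendsto_nhds_unique h5 tendsto_const_nhds

/-- The minimal cone is generated by product vectors, so for this composite positivity of a local
map already implies complete positivity. -/
theorem map_mem_minTensor {φ : V →ₗ[ℝ] V} {ψ : W →ₗ[ℝ] W} (hφ : ∀ a ∈ A.cone, φ a ∈ A.cone)
    (hψ : ∀ b ∈ B.cone, ψ b ∈ B.cone) {X : V ⊗[ℝ] W} (hX : X ∈ (A.minTensor B).cone) :
    TensorProduct.map φ ψ X ∈ (A.minTensor B).cone := by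
  change X ∈ Submodule.span _ _ at hX
  induction hX using Submodule.span_induction with
  | mem x hx =>
    obtain ⟨a, ha, b, hb, rfl⟩ := hx
    exact PointedCone.tmul_mem_minTensorProduct (hφ a ha) (hψ b hb)
  | zero => simp
  | add x y _ _ hx hy =>
    rw [map_add]
    exact add_mem hx hy
  | smul c x _ hx =>
    have : TensorProduct.map φ ψ (c • x) = c • TensorProduct.map φ ψ x :=
      map_smul (TensorProduct.map φ ψ) (c : ℝ) x
    rw [this]
    exact Submodule.smul_mem _ c hx

theorem isInstrumentLeft_of_pos {ι : Type*} [Fintype ι] {φ : ι → V →ₗ[ℝ] V}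
    (h : ∀ i, ∀ a ∈ A.cone, φ i a ∈ A.cone) (h1 : ∑ i, A.unit ∘ₗ φ i = A.unit) :
    IsInstrumentLeft A (A.minTensor B) φ :=
  ⟨fun i _ hX => map_mem_minTensor (h i) (fun _ hb => hb) hX, h1⟩

theorem isInstrumentRight_of_pos {ι : Type*} [Fintype ι] {ψ : ι → W →ₗ[ℝ] W}
    (h : ∀ i, ∀ b ∈ B.cone, ψ i b ∈ B.cone) (h1 : ∑ i, B.unit ∘ₗ ψ i = B.unit) :
    IsInstrumentRight B (A.minTensor B) ψ :=
  ⟨fun i _ hX => map_mem_minTensor (fun _ ha => ha) (h i) hX, h1⟩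

/-- The instrument that performs a measurement and prepares a fixed state. -/
theorem GPT.smulRight_pos (A : GPT V) {e : FunctionalFamily V} (he : e ∈ A.measurements) {a : V}
    (ha : a ∈ A.states) : (∀ i, ∀ x ∈ A.cone, (e.2 i).smulRight a x ∈ A.cone) ∧
      ∑ i, A.unit ∘ₗ (e.2 i).smulRight a = A.unit := by
  constructor
  · intro i x hx
    exact A.cone.smul_mem ((he.1 i).1 hx) ha.1
  · rw [← he.2]
    refine Finset.sum_congr rfl fun i _ => LinearMap.ext fun x => ?_
    simp [he.2, ha.2]

/-- A round in which nobody acts. It makes a constant sequence a legitimate LOCC sequence, so finite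
protocols are LOCC. -/
theorem isLOCCLinked_self (Φ : MapFamily V W) : IsLOCCLinked A B (A.minTensor B) Φ Φ := by
  classical
  refine ⟨fun _ => ⟨1, fun _ => LinearMap.id⟩, fun i => ⟨fun _ => LinearMap.id, fun _ => LinearMap.id,
    fun _ => TensorProduct.map_id.symm, Or.inl ⟨isInstrumentLeft_of_pos (fun _ _ h => h) (by simp),
      fun _ => isInstrumentRight_of_pos (fun _ _ h => h) (by simp)⟩⟩, fun p => p.1,
    fun i => ⟨⟨i, 0⟩, rfl⟩, fun j => ?_⟩
  rw [Finset.sum_filter, Fintype.sum_sigma]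
  simp

/-- Each party measures and then prepares a fixed state. The first outcome selects the measurement
of the second party, and the coarse graining is carried out in the linking round. -/
theorem measurementsOneWay_subset (hA : A.states.Nonempty) (hB : B.states.Nonempty) :
    measurementsOneWay A B ⊆ measurementsLOCC A B (A.minTensor B) := by
  classical
  obtain ⟨a, ha⟩ := hA
  obtain ⟨b, hb⟩ := hB
  rintro ⟨l, E⟩ ⟨e, he, k, f, hf, g, hgs, hg⟩
  let φ : Fin e.1 → V →ₗ[ℝ] V := fun i => (e.2 i).smulRight a
  let ψ : Fin e.1 → Fin k → W →ₗ[ℝ] W := fun i j => (f i j).smulRight b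
  have hφ := A.smulRight_pos he ha
  have hψ := fun i => B.smulRight_pos (hf i) hb
  let Ψ : MapFamily V W := ⟨e.1, fun i => TensorProduct.map (φ i) LinearMap.id⟩
  let Φ : MapFamily V W :=
    ⟨l, fun j => ∑ p : Fin e.1 × Fin k with g p = j, TensorProduct.map (φ p.1) (ψ p.1 p.2)⟩
  have h1 : IsFiniteLOCC A B (A.minTensor B) Ψ :=
    .one Ψ Ψ ⟨φ, fun _ => LinearMap.id, fun _ => rfl, Or.inl ⟨isInstrumentLeft_of_pos hφ.1 hφ.2,
      fun _ => isInstrumentRight_of_pos (fun _ _ h => h) (by simp)⟩⟩ (.refl _)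
  have h2 : IsLOCCLinked A B (A.minTensor B) Φ Ψ := by
    refine ⟨fun i => ⟨k, fun j => TensorProduct.map LinearMap.id (ψ i j)⟩, fun i =>
      ⟨fun _ => LinearMap.id, ψ i, fun _ => rfl, Or.inr ⟨isInstrumentRight_of_pos (hψ i).1 (hψ i).2,
        fun _ => isInstrumentLeft_of_pos (fun _ _ h => h) (by simp)⟩⟩, fun p => g (p.1, p.2), ?_,
      fun j => ?_⟩
    · intro j
      obtain ⟨p, hp⟩ := hgs j
      exact ⟨⟨p.1, p.2⟩, hp⟩
    · change ∑ p : Fin e.1 × Fin k with g p = j, TensorProduct.map (φ p.1) (ψ p.1 p.2) = _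
      rw [Finset.sum_filter, Finset.sum_filter, Fintype.sum_prod_type, Fintype.sum_sigma]
      refine Finset.sum_congr rfl fun i _ => Finset.sum_congr rfl fun m _ => ?_
      simp only [Ψ, ← TensorProduct.map_comp, LinearMap.id_comp, LinearMap.comp_id]
  have h3 := h1.link _ _ h2
  refine ⟨Φ.2, ⟨fun _ => Φ, fun _ => Φ.2, fun _ => h3, fun _ => isLOCCLinked_self Φ, fun _ => .refl _,
    fun _ _ _ => tendsto_const_nhds⟩, fun j => ?_⟩
  have hj := hg j
  simp only at hj
  simp only
  rw [hj]
  refine TensorProduct.ext' fun v w => ?_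
  simp only [Φ, LinearMap.comp_apply, LinearMap.sum_apply, map_sum, TensorProduct.map_tmul,
    prodFunctional_tmul]
  refine Finset.sum_congr ?_ fun p _ => ?_
  · congr!
  · change _ = prodFunctional A.unit B.unit _
    simp [φ, ψ, ha.2, hb.2, mul_comm]

theorem measurementsLO_subset_SEP (hA : A.states.Nonempty) (hB : B.states.Nonempty) :
    measurementsLO A B ⊆ measurementsSEP A B (A.minTensor B) := by
  intro E hE
  -- That the family is a measurement on the composite comes from the chain LO, one-way LOCC, LOCC;
  -- separability of the elements comes from sums of products.
  refine ⟨maxPositiveMeasurements_subset (measurementsLOCC_subset hA hB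
    (measurementsOneWay_subset hA hB (measurementsLO_subset_oneWay hE))), fun j => ?_⟩
  obtain ⟨e, he, f, hf, hg⟩ := hE
  obtain ⟨Z, hZ, h⟩ := hg.mem (S := (PointedCone.minTensorProduct A.dualCone
    B.dualCone).toAddSubmonoid.map (TensorProduct.dualDistrib ℝ V W).toAddMonoidHom)
    (fun p => ⟨_, PointedCone.tmul_mem_minTensorProduct (he.1 p.1).1 (hf.1 p.2).1, rfl⟩) j
  exact ⟨Z, hZ, h.symm⟩

theorem LocalClass.measurementsLO_subset (c : LocalClass) (hA : A.states.Nonempty)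
    (hB : B.states.Nonempty) : measurementsLO A B ⊆ c.measurements A B (A.minTensor B) :=
  match c with
  | .LO => subset_rfl
  | .LOCCOneWay => measurementsLO_subset_oneWay
  | .LOCC => measurementsLO_subset_oneWay.trans (measurementsOneWay_subset hA hB)
  | .SEP => measurementsLO_subset_SEP hA hB

theorem LocalClass.measurements_subset (c : LocalClass) (hA : A.states.Nonempty)
    (hB : B.states.Nonempty) :
    c.measurements A B (A.minTensor B) ⊆ maxPositiveMeasurements A B :=
  match c with
  | .LO => measurementsLO_subset_oneWay.trans
      ((measurementsOneWay_subset hA hB).trans (measurementsLOCC_subset hA hB))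
  | .LOCCOneWay => (measurementsOneWay_subset hA hB).trans (measurementsLOCC_subset hA hB)
  | .LOCC => measurementsLOCC_subset hA hB
  | .SEP => measurementsSEP_subset

/-- The product of two binary measurements, as an LO measurement. -/
theorem exists_mem_LO {f : Dual ℝ V} {g : Dual ℝ W} (hf1 : A.unit - f ∈ A.dualCone)
    (hf2 : f + A.unit ∈ A.dualCone) (hg1 : B.unit - g ∈ B.dualCone) (hg2 : g + B.unit ∈ B.dualCone) :
    ∃ E ∈ measurementsLO A B, ∀ X, |prodFunctional f g X| ≤ ∑ i, |E.2 i X| := by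
  classical
  have e : Fin 2 × Fin 2 ≃ Fin 4 := finProdFinEquiv
  let p : Fin 2 → Dual ℝ V := ![(2⁻¹ : ℝ) • (A.unit + f), (2⁻¹ : ℝ) • (A.unit - f)]
  let q : Fin 2 → Dual ℝ W := ![(2⁻¹ : ℝ) • (B.unit + g), (2⁻¹ : ℝ) • (B.unit - g)]
  refine ⟨⟨4, fun i => prodFunctional (p (e.symm i).1) (q (e.symm i).2)⟩,
    ⟨⟨2, p⟩, A.binary_mem hf1 hf2, ⟨2, q⟩, B.binary_mem hg1 hg2, e, e.surjective, fun j => ?_⟩,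
    fun X => ?_⟩
  · have hj : (Finset.univ.filter fun i : Fin 2 × Fin 2 => e i = j) = {e.symm j} := by
      ext i
      simp [Equiv.eq_symm_apply]
    change prodFunctional (p (e.symm j).1) (q (e.symm j).2)
      = Finset.sum _ fun i : Fin 2 × Fin 2 => prodFunctional (p i.1) (q i.2)
    convert (Finset.sum_singleton (fun i : Fin 2 × Fin 2 => prodFunctional (p i.1) (q i.2))
      (e.symm j)).symm
    rw [← hj]
    congr!
  · change _ ≤ ∑ i : Fin 4, |prodFunctional (p (e.symm i).1) (q (e.symm i).2) X|
    rw [← e.sum_comp, Fintype.sum_prod_type, Fin.sum_univ_two, Fin.sum_univ_two, Fin.sum_univ_two]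
    simp only [Equiv.symm_apply_apply]
    -- Each local functional is the difference of its two effects, so `f ⊗ g` is a signed sum of the
    -- four product effects.
    have key : prodFunctional f g = prodFunctional (p 0) (q 0) - prodFunctional (p 0) (q 1)
        - prodFunctional (p 1) (q 0) + prodFunctional (p 1) (q 1) := by
      refine TensorProduct.ext' fun v w => ?_
      simp [p, q]
      ring
    rw [key, LinearMap.add_apply, LinearMap.sub_apply, LinearMap.sub_apply]
    refine (abs_add_le _ _).trans (add_le_add ((abs_sub _ _).trans
      (add_le_add (abs_sub _ _) le_rfl)) le_rfl) |>.trans ?_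
    linarith

end Classes

/-! ### The injective and the projective norm -/

section TensorNorms

variable {E F : Type*} [NormedAddCommGroup E] [NormedSpace ℝ E]
  [NormedAddCommGroup F] [NormedSpace ℝ F]

theorem exists_bound_prodFunctional (M : E ⊗[ℝ] F) : ∃ c : ℝ, ∀ (f : Dual ℝ E) (g : Dual ℝ F),
    (∀ x, |f x| ≤ ‖x‖) → (∀ y, |g y| ≤ ‖y‖) → |prodFunctional f g M| ≤ c := by
  induction M using TensorProduct.induction_on with
  | zero => exact ⟨0, by simp⟩
  | tmul x y =>
    refine ⟨‖x‖ * ‖y‖, fun f g hf hg => ?_⟩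
    rw [prodFunctional_tmul, abs_mul]
    exact mul_le_mul (hf x) (hg y) (abs_nonneg _) (norm_nonneg _)
  | add M N hM hN =>
    obtain ⟨c, hc⟩ := hM
    obtain ⟨d, hd⟩ := hN
    refine ⟨c + d, fun f g hf hg => ?_⟩
    rw [map_add]
    exact (abs_add_le _ _).trans (add_le_add (hc f g hf hg) (hd f g hf hg))

theorem strongDual_abs_le {f : StrongDual ℝ E} (hf : ‖f‖ ≤ 1) (x : E) : |f.toLinearMap x| ≤ ‖x‖ :=
  (f.le_opNorm x).trans (mul_le_of_le_one_left (norm_nonneg x) hf)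

theorem bddAbove_injectiveNorm (M : E ⊗[ℝ] F) :
    BddAbove {r | ∃ (f : StrongDual ℝ E) (g : StrongDual ℝ F), ‖f‖ ≤ 1 ∧ ‖g‖ ≤ 1 ∧
      r = prodFunctional f.toLinearMap g.toLinearMap M} := by
  obtain ⟨c, hc⟩ := exists_bound_prodFunctional M
  refine ⟨c, ?_⟩
  rintro _ ⟨f, g, hf, hg, rfl⟩
  exact (le_abs_self _).trans (hc _ _ (strongDual_abs_le hf) (strongDual_abs_le hg))

theorem injectiveNorm_le {M : E ⊗[ℝ] F} {c : ℝ} (h : ∀ (f : Dual ℝ E) (g : Dual ℝ F),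
    (∀ x, |f x| ≤ ‖x‖) → (∀ y, |g y| ≤ ‖y‖) → prodFunctional f g M ≤ c) : injectiveNorm M ≤ c := by
  refine csSup_le ⟨_, 0, 0, by simp, by simp, rfl⟩ ?_
  rintro _ ⟨f, g, hf, hg, rfl⟩
  exact h _ _ (strongDual_abs_le hf) (strongDual_abs_le hg)

theorem prodFunctional_le_injectiveNorm {f : Dual ℝ E} {g : Dual ℝ F} (hf : ∀ x, |f x| ≤ ‖x‖)
    (hg : ∀ y, |g y| ≤ ‖y‖) (M : E ⊗[ℝ] F) : prodFunctional f g M ≤ injectiveNorm M := by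
  refine le_csSup (bddAbove_injectiveNorm M) ⟨f.mkContinuous 1 fun x => by simpa using hf x,
    g.mkContinuous 1 fun y => by simpa using hg y, ?_, ?_, rfl⟩
  · exact LinearMap.mkContinuous_norm_le _ zero_le_one _
  · exact LinearMap.mkContinuous_norm_le _ zero_le_one _

theorem prodFunctional_neg_left {V W : Type*} [AddCommGroup V] [Module ℝ V] [AddCommGroup W]
    [Module ℝ W] (f : Dual ℝ V) (g : Dual ℝ W) : prodFunctional (-f) g = -prodFunctional f g :=
  TensorProduct.ext' fun v w => by simp

theorem prodFunctional_smul_smul {V W : Type*} [AddCommGroup V] [Module ℝ V] [AddCommGroup W]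
    [Module ℝ W] (a b : ℝ) (f : Dual ℝ V) (g : Dual ℝ W) :
    prodFunctional (a • f) (b • g) = (a * b) • prodFunctional f g :=
  TensorProduct.ext' fun v w => by simp; ring

theorem abs_prodFunctional_le_injectiveNorm {f : Dual ℝ E} {g : Dual ℝ F} (hf : ∀ x, |f x| ≤ ‖x‖)
    (hg : ∀ y, |g y| ≤ ‖y‖) (M : E ⊗[ℝ] F) : |prodFunctional f g M| ≤ injectiveNorm M := by
  refine abs_le'.2 ⟨prodFunctional_le_injectiveNorm hf hg M, ?_⟩
  have := prodFunctional_le_injectiveNorm (f := -f) (fun x => by simpa using hf x) hg M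
  rwa [prodFunctional_neg_left] at this

/-- Normalises a functional without excluding `c = 0`, where `h` vanishes and `k = 0` serves. -/
theorem exists_eq_smul_of_abs_le {h : Dual ℝ E} {c : ℝ} (hc : 0 ≤ c)
    (hh : ∀ x, |h x| ≤ c * ‖x‖) : ∃ k : Dual ℝ E, h = c • k ∧ ∀ x, |k x| ≤ ‖x‖ := by
  rcases hc.eq_or_lt with rfl | hc
  · exact ⟨0, LinearMap.ext fun x => by simpa using hh x, by simp⟩
  · refine ⟨c⁻¹ • h, by simp [smul_smul, hc.ne'], fun x => ?_⟩
    rw [LinearMap.smul_apply, smul_eq_mul, abs_mul, abs_inv, abs_of_pos hc, inv_mul_le_iff₀ hc]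
    exact hh x

theorem abs_prodFunctional_le_mul_injectiveNorm {f : Dual ℝ E} {g : Dual ℝ F} {a b : ℝ} (ha : 0 ≤ a)
    (hb : 0 ≤ b) (hf : ∀ x, |f x| ≤ a * ‖x‖) (hg : ∀ y, |g y| ≤ b * ‖y‖) (M : E ⊗[ℝ] F) :
    |prodFunctional f g M| ≤ a * b * injectiveNorm M := by
  obtain ⟨k, rfl, hk⟩ := exists_eq_smul_of_abs_le ha hf
  obtain ⟨l, rfl, hl⟩ := exists_eq_smul_of_abs_le hb hg
  rw [prodFunctional_smul_smul, LinearMap.smul_apply, smul_eq_mul, abs_mul,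
    abs_of_nonneg (mul_nonneg ha hb)]
  exact mul_le_mul_of_nonneg_left (abs_prodFunctional_le_injectiveNorm hk hl M) (mul_nonneg ha hb)

theorem injectiveNorm_nonneg (M : E ⊗[ℝ] F) : 0 ≤ injectiveNorm M :=
  (abs_nonneg _).trans (abs_prodFunctional_le_injectiveNorm (f := 0) (g := 0) (by simp) (by simp) M)

variable (E F) in
/-- The injective norm as a seminorm. -/
noncomputable def injectiveSeminorm : Seminorm ℝ (E ⊗[ℝ] F) :=
  Seminorm.ofSMulLE injectiveNorm
    (le_antisymm (injectiveNorm_le (by simp)) (injectiveNorm_nonneg 0))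
    (fun M N => injectiveNorm_le fun f g hf hg => by
      rw [map_add]
      exact add_le_add (prodFunctional_le_injectiveNorm hf hg M)
        (prodFunctional_le_injectiveNorm hf hg N))
    (fun a M => injectiveNorm_le fun f g hf hg => by
      rw [map_smul, smul_eq_mul]
      refine (le_abs_self _).trans ?_
      rw [abs_mul]
      exact mul_le_mul_of_nonneg_left (abs_prodFunctional_le_injectiveNorm hf hg M) (abs_nonneg a))

/-- The costs `∑ i, ‖x i‖ * ‖y i‖` of the representations `M = ∑ i, x i ⊗ y i`. -/
def projectiveCosts (M : E ⊗[ℝ] F) : Set ℝ :=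
  {r | ∃ (k : ℕ) (x : Fin k → E) (y : Fin k → F), M = ∑ i, x i ⊗ₜ[ℝ] y i ∧
    r = ∑ i, ‖x i‖ * ‖y i‖}

theorem tmul_mem_projectiveCosts (x : E) (y : F) : ‖x‖ * ‖y‖ ∈ projectiveCosts (x ⊗ₜ[ℝ] y) :=
  ⟨1, fun _ => x, fun _ => y, by simp, by simp⟩

theorem add_mem_projectiveCosts {M N : E ⊗[ℝ] F} {r s : ℝ} (hr : r ∈ projectiveCosts M)
    (hs : s ∈ projectiveCosts N) : r + s ∈ projectiveCosts (M + N) := by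
  obtain ⟨k, x, y, rfl, rfl⟩ := hr
  obtain ⟨l, v, w, rfl, rfl⟩ := hs
  exact ⟨k + l, Fin.append x v, Fin.append y w, by simp [Fin.sum_univ_add],
    by simp [Fin.sum_univ_add]⟩

theorem smul_mem_projectiveCosts {M : E ⊗[ℝ] F} {r : ℝ} (a : ℝ) (hr : r ∈ projectiveCosts M) :
    |a| * r ∈ projectiveCosts (a • M) := by
  obtain ⟨k, x, y, rfl, rfl⟩ := hr
  refine ⟨k, fun i => a • x i, y, ?_, ?_⟩
  · simp [Finset.smul_sum, TensorProduct.smul_tmul']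
  · simp [Finset.mul_sum, norm_smul, mul_assoc]

theorem projectiveCosts_nonempty (M : E ⊗[ℝ] F) : (projectiveCosts M).Nonempty := by
  induction M using TensorProduct.induction_on with
  | zero => exact ⟨0, 0, ![], ![], by simp, by simp⟩
  | tmul x y => exact ⟨_, tmul_mem_projectiveCosts x y⟩
  | add M N hM hN =>
    obtain ⟨r, hr⟩ := hM
    obtain ⟨s, hs⟩ := hN
    exact ⟨_, add_mem_projectiveCosts hr hs⟩

theorem projectiveNorm_le {M : E ⊗[ℝ] F} {r : ℝ} (hr : r ∈ projectiveCosts M) :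
    projectiveNorm M ≤ r := by
  refine csInf_le ⟨0, ?_⟩ hr
  rintro _ ⟨k, x, y, -, rfl⟩
  positivity

theorem le_projectiveNorm {M : E ⊗[ℝ] F} {c : ℝ} (h : ∀ r ∈ projectiveCosts M, c ≤ r) :
    c ≤ projectiveNorm M :=
  le_csInf (projectiveCosts_nonempty M) h

theorem dual_le_projectiveNorm {β : Dual ℝ (E ⊗[ℝ] F)} (hβ : ∀ x y, β (x ⊗ₜ y) ≤ ‖x‖ * ‖y‖)
    (M : E ⊗[ℝ] F) : β M ≤ projectiveNorm M := by
  refine le_projectiveNorm ?_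
  rintro _ ⟨k, x, y, rfl, rfl⟩
  rw [map_sum]
  exact Finset.sum_le_sum fun i _ => hβ _ _

theorem projectiveNorm_nonneg (M : E ⊗[ℝ] F) : 0 ≤ projectiveNorm M := by
  refine le_projectiveNorm ?_
  rintro _ ⟨k, x, y, -, rfl⟩
  positivity

theorem injectiveNorm_le_projectiveNorm (M : E ⊗[ℝ] F) : injectiveNorm M ≤ projectiveNorm M :=
  injectiveNorm_le fun f g hf hg => dual_le_projectiveNorm (fun x y => by
    rw [prodFunctional_tmul]
    refine (le_abs_self _).trans ?_
    rw [abs_mul]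
    exact mul_le_mul (hf x) (hg y) (abs_nonneg _) (norm_nonneg _)) M

variable (E F) in
/-- The projective norm as a seminorm. -/
noncomputable def projectiveSeminorm : Seminorm ℝ (E ⊗[ℝ] F) :=
  Seminorm.ofSMulLE projectiveNorm
    (le_antisymm (projectiveNorm_le ⟨0, ![], ![], by simp, by simp⟩) (projectiveNorm_nonneg 0))
    (fun M N => by
      rw [← sub_le_iff_le_add]
      refine le_projectiveNorm fun r hr => ?_
      rw [sub_le_iff_le_add, ← sub_le_iff_le_add']
      refine le_projectiveNorm fun s hs => ?_
      rw [sub_le_iff_le_add']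
      exact projectiveNorm_le (add_mem_projectiveCosts hr hs))
    (fun a M => by
      rw [Real.norm_eq_abs]
      rcases eq_or_ne a 0 with rfl | ha
      · obtain ⟨r, hr⟩ := projectiveCosts_nonempty M
        simpa using projectiveNorm_le (smul_mem_projectiveCosts 0 hr)
      · have ha' : 0 < |a| := abs_pos.2 ha
        rw [← div_le_iff₀' ha']
        refine le_projectiveNorm fun r hr => ?_
        rw [div_le_iff₀' ha']
        exact projectiveNorm_le (smul_mem_projectiveCosts a hr))

theorem projectiveNorm_smul (a : ℝ) (M : E ⊗[ℝ] F) :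
    projectiveNorm (a • M) = |a| * projectiveNorm M :=
  map_smul_eq_mul (projectiveSeminorm E F) a M

theorem injectiveNorm_smul (a : ℝ) (M : E ⊗[ℝ] F) :
    injectiveNorm (a • M) = |a| * injectiveNorm M :=
  map_smul_eq_mul (injectiveSeminorm E F) a M

/-- The projective norm is attained by a bilinear form of norm at most one. -/
theorem exists_dual_eq_projectiveNorm (M : E ⊗[ℝ] F) :
    ∃ β : Dual ℝ (E ⊗[ℝ] F), (∀ x y, β (x ⊗ₜ y) ≤ ‖x‖ * ‖y‖) ∧ β M = projectiveNorm M := by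
  rcases eq_or_ne M 0 with rfl | hM
  · exact ⟨0, fun x y => by simpa using by positivity,
      (map_zero (projectiveSeminorm E F)).symm⟩
  let f : E ⊗[ℝ] F →ₗ.[ℝ] ℝ := LinearPMap.mkSpanSingleton M (projectiveNorm M) hM
  obtain ⟨β, h1, h2⟩ := exists_extension_of_le_sublinear f projectiveNorm
    (fun c hc x => by rw [projectiveNorm_smul, abs_of_pos hc])
    (map_add_le_add (projectiveSeminorm E F)) (by
      rintro ⟨x, hx⟩
      obtain ⟨c, rfl⟩ := Submodule.mem_span_singleton.1 hx
      have h3 : f ⟨c • M, hx⟩ = c • projectiveNorm M := LinearPMap.mkSpanSingleton'_apply _ _ _ _ _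
      rw [h3, projectiveNorm_smul, smul_eq_mul]
      exact mul_le_mul_of_nonneg_right (le_abs_self c) (projectiveNorm_nonneg M))
  refine ⟨β, fun x y => (h2 _).trans (projectiveNorm_le (tmul_mem_projectiveCosts x y)), ?_⟩
  have h3 := h1 ⟨M, Submodule.mem_span_singleton_self M⟩
  rw [h3]
  exact LinearPMap.mkSpanSingleton_apply ℝ ℝ hM _

theorem prodFunctional_hat (f : Dual ℝ (ℝ × E)) (g : Dual ℝ (ℝ × F)) (M : E ⊗[ℝ] F) :
    prodFunctional f g (hat M)
      = prodFunctional (f ∘ₗ LinearMap.inr ℝ ℝ E) (g ∘ₗ LinearMap.inr ℝ ℝ F) M := by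
  rw [← prodFunctional_map]
  rfl

end TensorNorms

/-! ### Centrally symmetric models -/

section CentrallySymmetricModels

variable {E F : Type*} [NormedAddCommGroup E] [NormedSpace ℝ E] [FiniteDimensional ℝ E]
  [NormedAddCommGroup F] [NormedSpace ℝ F] [FiniteDimensional ℝ F]

theorem centrallySymmetric_states_nonempty : (centrallySymmetric E).states.Nonempty :=
  ⟨(1, 0), by change ‖(0 : E)‖ ≤ 1; simp, rfl⟩

/-- The dual cone is again of centrally symmetric form, for the dual norm, as evaluation at `(‖x‖, ±
x)` shows. -/
theorem abs_le_of_mem_dualCone {f : Dual ℝ (ℝ × E)} (hf : f ∈ (centrallySymmetric E).dualCone)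
    (x : E) : |f (0, x)| ≤ f (1, 0) * ‖x‖ := by
  have h : ∀ y : E, ‖y‖ = ‖x‖ → 0 ≤ f (1, 0) * ‖x‖ + f (0, y) := by
    intro y hy
    have h1 : 0 ≤ f (‖x‖, y) := hf (show ‖y‖ ≤ ‖x‖ from hy.le)
    have h2 : ((‖x‖, y) : ℝ × E) = ‖x‖ • ((1, 0) : ℝ × E) + (0, y) := by simp
    rw [h2, map_add, map_smul, smul_eq_mul] at h1
    linarith
  have h1 := h x rfl
  have h2 := h (-x) (norm_neg x)
  have h3 : ((0, -x) : ℝ × E) = -(0, x) := by simp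
  rw [h3, map_neg] at h2
  exact abs_le.2 ⟨by linarith, by linarith⟩

theorem GPT.unit_sub_mem (A : GPT (ℝ × E)) {f : Dual ℝ (ℝ × E)}
    (hf : ∀ y ∈ A.cone, |f y| ≤ A.unit y) :
    A.unit - f ∈ A.dualCone ∧ f + A.unit ∈ A.dualCone := by
  constructor
  · intro y hy
    have := (abs_le.1 (hf y hy)).2
    change 0 ≤ A.unit y - f y
    linarith
  · intro y hy
    have := (abs_le.1 (hf y hy)).1
    change 0 ≤ f y + A.unit y
    linarith

/-- This is where the injective norm enters as an upper bound: a product of dual cone elements sees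
`M` through functionals whose norms are at most their values at `(1, 0)`. -/
theorem smul_sub_hat_mem_maxTensor (M : E ⊗[ℝ] F) :
    injectiveNorm M • (((1, 0) : ℝ × E) ⊗ₜ[ℝ] ((1, 0) : ℝ × F)) - hat M ∈
        PointedCone.maxTensorProduct (centrallySymmetric E).cone (centrallySymmetric F).cone ∧
      injectiveNorm M • (((1, 0) : ℝ × E) ⊗ₜ[ℝ] ((1, 0) : ℝ × F)) + hat M ∈
        PointedCone.maxTensorProduct (centrallySymmetric E).cone (centrallySymmetric F).cone := by
  have key : ∀ e ∈ (centrallySymmetric E).dualCone, ∀ f ∈ (centrallySymmetric F).dualCone,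
      |prodFunctional e f (hat M)| ≤ e (1, 0) * f (1, 0) * injectiveNorm M := by
    intro e he f hf
    rw [prodFunctional_hat]
    exact abs_prodFunctional_le_mul_injectiveNorm
      (he (show ‖(0 : E)‖ ≤ 1 by simp)) (hf (show ‖(0 : F)‖ ≤ 1 by simp))
      (abs_le_of_mem_dualCone he) (abs_le_of_mem_dualCone hf) M
  constructor <;> rw [mem_maxTensor] <;> intro e he f hf <;> have h := abs_le.1 (key e he f hf) <;>
    simp only [map_sub, map_add, map_smul, prodFunctional_tmul, smul_eq_mul] <;> linarith [h.1, h.2]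

theorem sum_abs_hat_le {X : FunctionalFamily ((ℝ × E) ⊗[ℝ] (ℝ × F))}
    (hX : X ∈ maxPositiveMeasurements (centrallySymmetric E) (centrallySymmetric F))
    (M : E ⊗[ℝ] F) : ∑ i, |X.2 i (hat M)| ≤ injectiveNorm M := by
  obtain ⟨h1, h2⟩ := smul_sub_hat_mem_maxTensor M
  calc ∑ i, |X.2 i (hat M)|
      ≤ ∑ i, injectiveNorm M * X.2 i (((1, 0) : ℝ × E) ⊗ₜ[ℝ] ((1, 0) : ℝ × F)) := by
        refine Finset.sum_le_sum fun i _ => ?_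
        have h3 := hX.1 i h1
        have h4 := hX.1 i h2
        rw [Dual.eval_apply, map_sub, map_smul, smul_eq_mul] at h3
        rw [Dual.eval_apply, map_add, map_smul, smul_eq_mul] at h4
        exact abs_le.2 ⟨by linarith, by linarith⟩
    _ = injectiveNorm M := by
        rw [← Finset.mul_sum, ← LinearMap.sum_apply, hX.2]
        simp [centrallySymmetric]

/-- The restricted distinguishability norms are all given by the injective norm. -/
theorem distNorm_hat (c : LocalClass) (M : E ⊗[ℝ] F) :
    distNorm (c.measurements (centrallySymmetric E) (centrallySymmetric F)
      ((centrallySymmetric E).minTensor (centrallySymmetric F))) (hat M) = injectiveNorm M := by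
  have hE := centrallySymmetric_states_nonempty (E := E)
  have hF := centrallySymmetric_states_nonempty (E := F)
  have hsub := c.measurements_subset hE hF
  have key : ∀ (f : Dual ℝ E) (g : Dual ℝ F), (∀ x, |f x| ≤ ‖x‖) → (∀ y, |g y| ≤ ‖y‖) →
      ∃ X ∈ measurementsLO (centrallySymmetric E) (centrallySymmetric F),
        prodFunctional f g M ≤ ∑ i, |X.2 i (hat M)| := by
    intro f g hf hg
    obtain ⟨h1, h2⟩ := (centrallySymmetric E).unit_sub_mem
      (f := f ∘ₗ LinearMap.snd ℝ ℝ E) fun y hy => (hf y.2).trans hy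
    obtain ⟨h3, h4⟩ := (centrallySymmetric F).unit_sub_mem
      (f := g ∘ₗ LinearMap.snd ℝ ℝ F) fun y hy => (hg y.2).trans hy
    obtain ⟨X, hX, h⟩ := exists_mem_LO h1 h2 h3 h4
    refine ⟨X, hX, (le_abs_self _).trans (le_trans (le_of_eq ?_) (h (hat M)))⟩
    rw [prodFunctional_hat]
    rfl
  refine le_antisymm (GPT.distNorm_le ?_ fun X hX => sum_abs_hat_le (hsub hX) M)
    (injectiveNorm_le fun f g hf hg => ?_)
  · obtain ⟨X, hX, -⟩ := key 0 0 (by simp) (by simp)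
    exact ⟨X, c.measurementsLO_subset hE hF hX⟩
  · obtain ⟨X, hX, h⟩ := key f g hf hg
    exact h.trans (GPT.le_distNorm (hsub.trans maxPositiveMeasurements_subset)
      (c.measurementsLO_subset hE hF hX) _)

theorem GPT.abs_apply_tmul_le {V W : Type*} [AddCommGroup V] [Module ℝ V] [FiniteDimensional ℝ V]
    [AddCommGroup W] [Module ℝ W] [FiniteDimensional ℝ W] {A : GPT V} {B : GPT W}
    {f : Dual ℝ (V ⊗[ℝ] W)} (h1 : (A.minTensor B).unit - f ∈ (A.minTensor B).dualCone)
    (h2 : f + (A.minTensor B).unit ∈ (A.minTensor B).dualCone) {a : V} {b : W} (ha : a ∈ A.cone)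
    (hb : b ∈ B.cone) : |f (a ⊗ₜ b)| ≤ A.unit a * B.unit b := by
  have h3 := h1 (PointedCone.tmul_mem_minTensorProduct ha hb)
  have h4 := h2 (PointedCone.tmul_mem_minTensorProduct ha hb)
  have h5 : (A.minTensor B).unit (a ⊗ₜ b) = A.unit a * B.unit b := prodFunctional_tmul _ _ _ _
  simp only [Dual.eval_apply, LinearMap.sub_apply, LinearMap.add_apply, h5] at h3 h4
  exact abs_le.2 ⟨by linarith, by linarith⟩

theorem GPT.states_minTensor_nonempty {V W : Type*} [AddCommGroup V] [Module ℝ V]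
    [FiniteDimensional ℝ V] [AddCommGroup W] [Module ℝ W] [FiniteDimensional ℝ W] {A : GPT V}
    {B : GPT W} (hA : A.states.Nonempty) (hB : B.states.Nonempty) :
    (A.minTensor B).states.Nonempty := by
  obtain ⟨a, ha⟩ := hA
  obtain ⟨b, hb⟩ := hB
  refine ⟨a ⊗ₜ b, PointedCone.tmul_mem_minTensorProduct ha.1 hb.1, ?_⟩
  exact (prodFunctional_tmul _ _ _ _).trans (by rw [ha.2, hb.2, one_mul])

theorem GPT.mem_dualCone_minTensor {V W : Type*} [AddCommGroup V] [Module ℝ V]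
    [FiniteDimensional ℝ V] [AddCommGroup W] [Module ℝ W] [FiniteDimensional ℝ W] {A : GPT V}
    {B : GPT W} {f : Dual ℝ (V ⊗[ℝ] W)} (h : ∀ a ∈ A.cone, ∀ b ∈ B.cone, 0 ≤ f (a ⊗ₜ b)) :
    f ∈ (A.minTensor B).dualCone := by
  unfold GPT.dualCone
  change f ∈ PointedCone.dual _ (PointedCone.minTensorProduct A.cone B.cone : Set (V ⊗[ℝ] W))
  rw [PointedCone.minTensorProduct, PointedCone.dual_hull]
  rintro _ ⟨a, ha, b, hb, rfl⟩
  exact h a ha b hb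

/-- The base norm is given by the projective norm. -/
theorem baseNorm_hat (M : E ⊗[ℝ] F) :
    ((centrallySymmetric E).minTensor (centrallySymmetric F)).baseNorm (hat M) = projectiveNorm M := by
  refine le_antisymm ?_ ?_
  · refine csSup_le ⟨_, 0, by simpa using GPT.unit_mem_dualCone _,
      by simpa using GPT.unit_mem_dualCone _, rfl⟩ ?_
    rintro _ ⟨f, h1, h2, rfl⟩
    refine dual_le_projectiveNorm (β := f ∘ₗ hat) (fun x y => ?_) M
    have h : ∀ (v : E) (w : F), ‖v‖ = ‖x‖ → ‖w‖ = ‖y‖ →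
        |f ((‖x‖, v) ⊗ₜ[ℝ] (‖y‖, w))| ≤ ‖x‖ * ‖y‖ := fun v w hv hw =>
      GPT.abs_apply_tmul_le h1 h2 (show ‖v‖ ≤ ‖x‖ from hv.le) (show ‖w‖ ≤ ‖y‖ from hw.le)
    -- Polarisation into four products of cone elements. Each of the four terms contributes at most
    -- `‖x‖ * ‖y‖`, so the factor `1 / 4` gives the exact constant.
    have e : hat (x ⊗ₜ[ℝ] y) = (4⁻¹ : ℝ) • ((‖x‖, x) ⊗ₜ[ℝ] (‖y‖, y) - (‖x‖, x) ⊗ₜ[ℝ] (‖y‖, -y)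
        - (‖x‖, -x) ⊗ₜ[ℝ] (‖y‖, y) + (‖x‖, -x) ⊗ₜ[ℝ] (‖y‖, -y)) := by
      have ex : (((2 : ℝ) • ((0, x) : ℝ × E))) = (‖x‖, x) - (‖x‖, -x) := by
        ext <;> simp [two_smul]
      have ey : (((2 : ℝ) • ((0, y) : ℝ × F))) = (‖y‖, y) - (‖y‖, -y) := by
        ext <;> simp [two_smul]
      have h3 : ((‖x‖, x) ⊗ₜ[ℝ] (‖y‖, y) - (‖x‖, x) ⊗ₜ[ℝ] (‖y‖, -y)
        - (‖x‖, -x) ⊗ₜ[ℝ] (‖y‖, y) + (‖x‖, -x) ⊗ₜ[ℝ] (‖y‖, -y) : (ℝ × E) ⊗[ℝ] (ℝ × F))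
          = ((2 : ℝ) • ((0, x) : ℝ × E)) ⊗ₜ[ℝ] ((2 : ℝ) • ((0, y) : ℝ × F)) := by
        rw [ex, ey, TensorProduct.sub_tmul, TensorProduct.tmul_sub, TensorProduct.tmul_sub]
        abel
      rw [h3, TensorProduct.smul_tmul_smul, smul_smul]
      norm_num
      rfl
    rw [LinearMap.comp_apply, e]
    have g1 := (abs_le.1 (h x y rfl rfl)).2
    have g2 := (abs_le.1 (h x (-y) rfl (norm_neg y))).1
    have g3 := (abs_le.1 (h (-x) y (norm_neg x) rfl)).1
    have g4 := (abs_le.1 (h (-x) (-y) (norm_neg x) (norm_neg y))).2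
    simp only [map_smul, map_add, map_sub, smul_eq_mul]
    linarith
  · obtain ⟨β, hβ, h⟩ := exists_dual_eq_projectiveNorm M
    have hβ' : ∀ x y, |β (x ⊗ₜ y)| ≤ ‖x‖ * ‖y‖ := by
      intro x y
      refine abs_le'.2 ⟨hβ x y, ?_⟩
      have := hβ (-x) y
      rwa [TensorProduct.neg_tmul, map_neg, norm_neg] at this
    -- The optimal bilinear form is extended by zero on the scalar components; it remains between
    -- minus and plus the unit because `‖a.2‖ ≤ a.1` on the cones.
    let T : (ℝ × E) ⊗[ℝ] (ℝ × F) →ₗ[ℝ] E ⊗[ℝ] F :=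
      TensorProduct.map (LinearMap.snd ℝ ℝ E) (LinearMap.snd ℝ ℝ F)
    have hT : T (hat M) = M := by
      have : T ∘ₗ hat = LinearMap.id := TensorProduct.ext' fun x y => by simp [T, hat]
      exact LinearMap.congr_fun this M
    have hb : ∀ a ∈ (centrallySymmetric E).cone, ∀ b ∈ (centrallySymmetric F).cone,
        |β (T (a ⊗ₜ b))| ≤ a.1 * b.1 := by
      intro a ha b hb
      have ha' : ‖a.2‖ ≤ a.1 := ha
      have hb' : ‖b.2‖ ≤ b.1 := hb
      exact (hβ' a.2 b.2).trans (mul_le_mul ha' hb' (norm_nonneg _) ((norm_nonneg _).trans ha'))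
    have hu : ∀ a b, ((centrallySymmetric E).minTensor (centrallySymmetric F)).unit (a ⊗ₜ b)
      = a.1 * b.1 := fun a b => prodFunctional_tmul _ _ _ _
    refine le_csSup (GPT.bddAbove_baseNorm _ _) ⟨β ∘ₗ T, ?_, ?_, by rw [LinearMap.comp_apply, hT, h]⟩
    · refine GPT.mem_dualCone_minTensor fun a ha b hb' => ?_
      have := (abs_le.1 (hb a ha b hb')).2
      rw [LinearMap.sub_apply, hu, LinearMap.comp_apply]
      linarith
    · refine GPT.mem_dualCone_minTensor fun a ha b hb' => ?_
      have := (abs_le.1 (hb a ha b hb')).1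
      rw [LinearMap.add_apply, hu, LinearMap.comp_apply]
      linarith

theorem restrictedRatios_eq (c : LocalClass) :
    restrictedRatios ((centrallySymmetric E).minTensor (centrallySymmetric F))
      (c.measurements (centrallySymmetric E) (centrallySymmetric F)
        ((centrallySymmetric E).minTensor (centrallySymmetric F)))
      = {r : ℝ | ∃ M : E ⊗[ℝ] F, M ≠ 0 ∧ r = projectiveNorm M / injectiveNorm M} := by
  simp only [restrictedRatios, baseNorm_hat, distNorm_hat]

/-- Every ratio of the projective to the injective norm is an efficiency of data hiding. -/
theorem ratio_mem_efficiencies (c : LocalClass) {M : E ⊗[ℝ] F} (hM : 0 < injectiveNorm M) :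
    projectiveNorm M / injectiveNorm M ∈
      dataHidingEfficiencies ((centrallySymmetric E).minTensor (centrallySymmetric F))
        (c.measurements (centrallySymmetric E) (centrallySymmetric F)
          ((centrallySymmetric E).minTensor (centrallySymmetric F))) := by
  set AB := (centrallySymmetric E).minTensor (centrallySymmetric F) with hAB
  have hpos : 0 < projectiveNorm M := hM.trans_le (injectiveNorm_le_projectiveNorm M)
  set N := (projectiveNorm M)⁻¹ • M with hN
  have hπ : projectiveNorm N = 1 := by
    rw [hN, projectiveNorm_smul, abs_inv, abs_of_pos hpos, inv_mul_cancel₀ hpos.ne']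
  have hε : injectiveNorm N = 1 / (projectiveNorm M / injectiveNorm M) := by
    rw [hN, injectiveNorm_smul, abs_inv, abs_of_pos hpos, one_div_div, inv_mul_eq_div]
  have hbase : AB.baseNorm (hat N) = 1 := by rw [hAB, baseNorm_hat, hπ]
  have hle : AB.baseNorm (hat N) ≤ distNorm AB.measurements (hat N) := by
    refine csSup_le ⟨_, 0, by simpa using GPT.unit_mem_dualCone _,
      by simpa using GPT.unit_mem_dualCone _, rfl⟩ ?_
    rintro _ ⟨f, h1, h2, rfl⟩
    exact AB.apply_le_distNorm_measurements h1 h2 _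
  have hAB0 : AB.states.Nonempty := GPT.states_minTensor_nonempty
    centrallySymmetric_states_nonempty centrallySymmetric_states_nonempty
  have hmem : hat N ∈ AB.mixtures := AB.mem_mixtures_of_forall_le_one hAB0 fun f h1 h2 =>
    hbase ▸ le_csSup (AB.bddAbove_baseNorm _) ⟨f, h1, h2, rfl⟩
  have hall : distNorm AB.measurements (hat N) = 1 :=
    le_antisymm (AB.distNorm_le_one_of_mem_mixtures hmem) (hbase ▸ hle)
  obtain ⟨ρ, hρ, σ, hσ, p, hp, hz⟩ := hmem
  refine ⟨(one_le_div₀ hM).2 (injectiveNorm_le_projectiveNorm M), ρ, hρ, σ, hσ, p, hp, ?_, ?_⟩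
  · rw [errorProb, ← hz, hall]; norm_num
  · rw [errorProb, ← hz, hAB, distNorm_hat, hε]; ring

end CentrallySymmetricModels

/-! ### Hartley matrices -/

section Hartley

theorem sum_exp_int (m : ℕ) (hm : m ≠ 0) (l : ℤ) :
    ∑ j : Fin m, Complex.exp (((l * j * (2 * Real.pi / m) : ℝ) : ℂ) * Complex.I)
      = if (m : ℤ) ∣ l then (m : ℂ) else 0 := by
  have hζ := Complex.isPrimitiveRoot_exp m hm
  set ζ := Complex.exp (2 * Real.pi * Complex.I / m) with hζ'
  have h1 : ∀ j : Fin m, Complex.exp (((l * j * (2 * Real.pi / m) : ℝ) : ℂ) * Complex.I)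
      = (ζ ^ l) ^ (j : ℕ) := by
    intro j
    rw [hζ', ← Complex.exp_int_mul, ← Complex.exp_nat_mul]
    congr 1
    push_cast
    ring
  simp only [h1]
  rw [Fin.sum_univ_eq_sum_range fun j => (ζ ^ l) ^ j]
  split_ifs with h
  · simp [(hζ.zpow_eq_one_iff_dvd l).2 h]
  · have h2 : ζ ^ l ≠ 1 := fun h' => h ((hζ.zpow_eq_one_iff_dvd l).1 h')
    have h3 := mul_geom_sum (ζ ^ l) m
    have h4 : (ζ ^ l) ^ m = 1 := by
      rw [← zpow_natCast, ← zpow_mul, mul_comm, zpow_mul, zpow_natCast, hζ.pow_eq_one, one_zpow]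
    rw [h4, sub_self, mul_eq_zero, sub_eq_zero] at h3
    exact h3.resolve_left h2

theorem sum_cos_int (m : ℕ) (hm : m ≠ 0) (l : ℤ) :
    ∑ j : Fin m, Real.cos (l * j * (2 * Real.pi / m)) = if (m : ℤ) ∣ l then (m : ℝ) else 0 := by
  have h := congrArg Complex.re (sum_exp_int m hm l)
  simp only [Complex.re_sum, Complex.exp_ofReal_mul_I_re] at h
  rw [h]
  split_ifs <;> simp

theorem sum_sin_int (m : ℕ) (hm : m ≠ 0) (l : ℤ) :
    ∑ j : Fin m, Real.sin (l * j * (2 * Real.pi / m)) = 0 := by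
  have h := congrArg Complex.im (sum_exp_int m hm l)
  simp only [Complex.im_sum, Complex.exp_ofReal_mul_I_im] at h
  rw [h]
  split_ifs <;> simp

/-- The first rows of the (unnormalised) Hartley matrix. -/
noncomputable def hartley (n m : ℕ) (i : Fin n) (j : Fin m) : ℝ :=
  Real.cos (i * j * (2 * Real.pi / m)) + Real.sin (i * j * (2 * Real.pi / m))

theorem abs_hartley_le {n m : ℕ} (i : Fin n) (j : Fin m) : |hartley n m i j| ≤ √2 := by
  refine Real.abs_le_sqrt ?_
  unfold hartley
  set θ : ℝ := i * j * (2 * Real.pi / m)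
  nlinarith [Real.sin_sq_add_cos_sq θ, sq_nonneg (Real.cos θ - Real.sin θ)]

/-- The product of two entries is `cos (a - b) + sin (a + b)`. Sine sums over full periods vanish,
and a cosine sum survives only if `m` divides `i - i'`, which forces `i = i'` because `n ≤ m`. -/
theorem sum_hartley_mul {n m : ℕ} (hnm : n ≤ m) (i i' : Fin n) :
    ∑ j, hartley n m i j * hartley n m i' j = if i = i' then (m : ℝ) else 0 := by
  have hm : m ≠ 0 := by have := i.pos; omega
  have h1 : ∀ j : Fin m, hartley n m i j * hartley n m i' j
      = Real.cos (((i : ℤ) - i' : ℤ) * j * (2 * Real.pi / m))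
        + Real.sin (((i : ℤ) + i' : ℤ) * j * (2 * Real.pi / m)) := by
    intro j
    have e1 : ((((i : ℤ) - i' : ℤ) : ℝ) * j * (2 * Real.pi / m))
        = i * j * (2 * Real.pi / m) - i' * j * (2 * Real.pi / m) := by push_cast; ring
    have e2 : ((((i : ℤ) + i' : ℤ) : ℝ) * j * (2 * Real.pi / m))
        = i * j * (2 * Real.pi / m) + i' * j * (2 * Real.pi / m) := by push_cast; ring
    rw [e1, e2, Real.cos_sub, Real.sin_add, hartley, hartley]
    ring
  simp only [h1, Finset.sum_add_distrib, sum_cos_int m hm, sum_sin_int m hm, add_zero]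
  congr 1
  rw [eq_iff_iff]
  constructor
  · intro h
    have h2 : ((i : ℤ) - i') = 0 := Int.eq_zero_of_abs_lt_dvd h (by
      rw [abs_lt]
      have := i.2
      have := i'.2
      constructor <;> omega)
    exact Fin.ext (by omega)
  · rintro rfl
    simp

theorem exists_flat_matrix_of_le {n m : ℕ} (hnm : n ≤ m) : ∃ H : Fin n → Fin m → ℝ,
    (∀ i j, |H i j| ≤ √2) ∧ ∑ i, ∑ j, H i j * H i j = n * m ∧
    ∀ (s : Fin n → ℝ) (t : Fin m → ℝ), ∑ i, ∑ j, s i * t j * H i j ≤ m * √n * (‖s‖ * ‖t‖) := by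
  refine ⟨hartley n m, abs_hartley_le, ?_, fun s t => ?_⟩
  · simp [sum_hartley_mul hnm]
  have hsq : ∀ {k : ℕ} (v : Fin k → ℝ), ∑ i, v i ^ 2 ≤ k * ‖v‖ ^ 2 := by
    intro k v
    have := Finset.sum_le_card_nsmul Finset.univ (fun i => v i ^ 2) (‖v‖ ^ 2) fun i _ => by
      rw [← sq_abs]
      exact pow_le_pow_left₀ (abs_nonneg _) (norm_le_pi_norm v i) 2
    simpa using this
  have h1 : ∑ j, (∑ i, s i * hartley n m i j) ^ 2 = m * ∑ i, s i ^ 2 := by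
    calc ∑ j, (∑ i, s i * hartley n m i j) ^ 2
        = ∑ i, ∑ i', s i * s i' * ∑ j, hartley n m i j * hartley n m i' j := by
          simp_rw [sq, Finset.sum_mul_sum, Finset.mul_sum]
          rw [Finset.sum_comm]
          refine Finset.sum_congr rfl fun i _ => ?_
          rw [Finset.sum_comm]
          exact Finset.sum_congr rfl fun i' _ => Finset.sum_congr rfl fun j _ => by
            ring
      _ = m * ∑ i, s i ^ 2 := by
          simp only [sum_hartley_mul hnm, mul_ite, mul_zero, Finset.sum_ite_eq, Finset.mem_univ,
            if_true, Finset.mul_sum]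
          exact Finset.sum_congr rfl fun i _ => by ring
  have h2 : ∑ i, ∑ j, s i * t j * hartley n m i j = ∑ j, t j * ∑ i, s i * hartley n m i j := by
    rw [Finset.sum_comm]
    refine Finset.sum_congr rfl fun j _ => ?_
    rw [Finset.mul_sum]
    exact Finset.sum_congr rfl fun i _ => by ring
  rw [h2]
  -- Cauchy-Schwarz over columns: orthogonal rows give a factor `√m`, and passing from the maximum
  -- to the Euclidean norm gives `√m` for `t` and `√n` for `s`.
  refine abs_le_of_sq_le_sq' ?_ (by positivity) |>.2
  calc _ ≤ (∑ j, t j ^ 2) * ∑ j, (∑ i, s i * hartley n m i j) ^ 2 :=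
        Finset.sum_mul_sq_le_sq_mul_sq _ _ _
    _ ≤ (m * ‖t‖ ^ 2) * (m * (n * ‖s‖ ^ 2)) := by
        rw [h1]
        gcongr
        · exact hsq t
        · exact hsq s
    _ = _ := by
        rw [mul_pow, mul_pow, Real.sq_sqrt (by positivity)]
        ring

theorem exists_flat_matrix (n m : ℕ) : ∃ H : Fin n → Fin m → ℝ,
    (∀ i j, |H i j| ≤ √2) ∧ ∑ i, ∑ j, H i j * H i j = n * m ∧
    ∀ (s : Fin n → ℝ) (t : Fin m → ℝ), ∑ i, ∑ j, s i * t j * H i j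
      ≤ (max n m : ℕ) * √(min n m : ℕ) * (‖s‖ * ‖t‖) := by
  rcases le_total n m with h | h
  · rw [max_eq_right h, min_eq_left h]
    exact exists_flat_matrix_of_le h
  · rw [max_eq_left h, min_eq_right h]
    obtain ⟨H, h1, h2, h3⟩ := exists_flat_matrix_of_le h
    refine ⟨fun i j => H j i, fun i j => h1 j i, ?_, fun s t => ?_⟩
    · rw [Finset.sum_comm, h2, mul_comm]
    · rw [Finset.sum_comm, mul_comm ‖s‖]
      simpa only [mul_comm (s _)] using h3 t s

end Hartley

/-! ### Cubic models -/

section Cubic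

theorem norm_sum_signs_le {n : ℕ} (s : Fin n → ℤˣ) :
    ‖∑ i, ((s i : ℤ) : ℝ) • Pi.basisFun ℝ (Fin n) i‖ ≤ 1 := by
  refine (pi_norm_le_iff_of_nonneg zero_le_one).2 fun k => ?_
  rcases Int.units_eq_one_or (s k) with h | h <;> simp [Finset.sum_apply, Pi.single_apply, h]

theorem abs_coord_le {n : ℕ} (i : Fin n) (x : Fin n → ℝ) :
    |(Pi.basisFun ℝ (Fin n)).coord i x| ≤ ‖x‖ := by
  simpa using norm_le_pi_norm x i

theorem projectiveNorm_le_injectiveNorm {n m : ℕ} (M : (Fin n → ℝ) ⊗[ℝ] (Fin m → ℝ)) :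
    projectiveNorm M ≤ √(2 * (min n m : ℕ)) * injectiveNorm M := by
  obtain ⟨β, hβ, h⟩ := exists_dual_eq_projectiveNorm M
  have := dual_le_of_coords (Pi.basisFun ℝ (Fin n)) (Pi.basisFun ℝ (Fin m)) β
    (fun s t => (hβ _ _).trans (mul_le_one₀ (norm_sum_signs_le s) (norm_nonneg _)
      (norm_sum_signs_le t))) M
    (fun i j => abs_prodFunctional_le_injectiveNorm (abs_coord_le i) (abs_coord_le j) M)
    (injectiveNorm_nonneg M)
  simpa [← h] using this

theorem injectiveNorm_pos {n m : ℕ} {M : (Fin n → ℝ) ⊗[ℝ] (Fin m → ℝ)} (hM : M ≠ 0) :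
    0 < injectiveNorm M := by
  refine (injectiveNorm_nonneg M).lt_of_ne fun h => hM ?_
  refine ((Pi.basisFun ℝ (Fin n)).tensorProduct (Pi.basisFun ℝ (Fin m))).ext_elem fun ⟨i, j⟩ => ?_
  have h1 := abs_prodFunctional_le_injectiveNorm (abs_coord_le i) (abs_coord_le j) M
  rw [← h] at h1
  have h2 : ((Pi.basisFun ℝ (Fin n)).tensorProduct (Pi.basisFun ℝ (Fin m))).coord (i, j)
      = prodFunctional ((Pi.basisFun ℝ (Fin n)).coord i) ((Pi.basisFun ℝ (Fin m)).coord j) :=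
    TensorProduct.ext' fun v w => by simp [Basis.tensorProduct_repr_tmul_apply, mul_comm]
  have h3 := LinearMap.congr_fun h2 M
  rw [abs_nonpos_iff.1 h1] at h3
  simpa using h3

theorem exists_ratio_ge {n m : ℕ} (hn : 1 ≤ n) (hm : 1 ≤ m) :
    ∃ M : (Fin n → ℝ) ⊗[ℝ] (Fin m → ℝ), M ≠ 0 ∧
      √((min n m : ℕ) / 2) ≤ projectiveNorm M / injectiveNorm M := by
  obtain ⟨H, h1, h2, h3⟩ := exists_flat_matrix n m
  set K : ℝ := (max n m : ℕ) * √(min n m : ℕ) with hK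
  have hmin : 0 < min n m := by omega
  have hmax : 0 < max n m := by omega
  have hs : (0 : ℝ) < √(min n m : ℕ) := Real.sqrt_pos.2 (by exact_mod_cast hmin)
  have hKpos : 0 < K := mul_pos (by exact_mod_cast hmax) hs
  let M : (Fin n → ℝ) ⊗[ℝ] (Fin m → ℝ) :=
    ∑ i, ∑ j, H i j • (Pi.basisFun ℝ (Fin n) i ⊗ₜ[ℝ] Pi.basisFun ℝ (Fin m) j)
  -- The same matrix, divided by the bound `K` on its bilinear form, witnesses the projective norm:
  -- the pairing is `n m / K = √(min n m)`.
  let β : Dual ℝ ((Fin n → ℝ) ⊗[ℝ] (Fin m → ℝ)) := K⁻¹ • ∑ i, ∑ j, H i j •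
    prodFunctional ((Pi.basisFun ℝ (Fin n)).coord i) ((Pi.basisFun ℝ (Fin m)).coord j)
  have hβ : ∀ x y, β (x ⊗ₜ y) ≤ ‖x‖ * ‖y‖ := by
    intro x y
    have h4 : β (x ⊗ₜ y) = K⁻¹ * ∑ i, ∑ j, x i * y j * H i j := by
      simp [β, mul_comm (H _ _)]
    rw [h4, inv_mul_le_iff₀ hKpos]
    exact h3 x y
  have hβM : β M = √(min n m : ℕ) := by
    have h4 : β M = K⁻¹ * ∑ i, ∑ j, H i j * H i j := by
      simp [β, M, Pi.single_apply, Finset.mul_sum, mul_left_comm]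
    have h5 : (n : ℝ) * m = (max n m : ℕ) * (min n m : ℕ) := by
      rw [← Nat.cast_mul, ← Nat.cast_mul, max_mul_min]
    rw [h4, h2, h5, inv_mul_eq_iff_eq_mul₀ hKpos.ne', hK, mul_assoc, Real.mul_self_sqrt (by positivity)]
  have hπ : √(min n m : ℕ) ≤ projectiveNorm M := hβM ▸ dual_le_projectiveNorm hβ M
  have hε : injectiveNorm M ≤ √2 := by
    -- The dual of the maximum norm is the `ℓ¹` norm, as testing on a sign vector shows; hence the
    -- injective norm is at most the largest entry.
    have hl1 : ∀ {k : ℕ} (f : Dual ℝ (Fin k → ℝ)), (∀ x, |f x| ≤ ‖x‖) →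
        ∑ i, |f (Pi.basisFun ℝ (Fin k) i)| ≤ 1 := by
      intro k f hf
      choose t ht using fun i => exists_sign_mul_eq_abs (f (Pi.basisFun ℝ (Fin k) i))
      have h := (le_abs_self _).trans ((hf _).trans (norm_sum_signs_le t))
      rw [map_sum] at h
      simp only [map_smul, smul_eq_mul, ← ht] at h
      exact h
    refine injectiveNorm_le fun f g hf hg => ?_
    calc prodFunctional f g M
        ≤ ∑ i, ∑ j, √2 * (|f (Pi.basisFun ℝ (Fin n) i)| * |g (Pi.basisFun ℝ (Fin m) j)|) := by
          simp only [M, map_sum, map_smul, prodFunctional_tmul, smul_eq_mul]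
          refine Finset.sum_le_sum fun i _ => Finset.sum_le_sum fun j _ => ?_
          refine (le_abs_self _).trans ?_
          rw [abs_mul, abs_mul]
          exact mul_le_mul_of_nonneg_right (h1 i j) (by positivity)
      _ = √2 * ((∑ i, |f (Pi.basisFun ℝ (Fin n) i)|) * ∑ j, |g (Pi.basisFun ℝ (Fin m) j)|) := by
          simp only [← Finset.mul_sum, Finset.sum_mul]
      _ ≤ √2 * 1 := by
          gcongr
          exact mul_le_one₀ (hl1 f hf) (Finset.sum_nonneg fun _ _ => abs_nonneg _) (hl1 g hg)
      _ = √2 := mul_one _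
  have hM : M ≠ 0 := by
    intro h
    rw [h, map_zero] at hβM
    exact hs.ne hβM
  refine ⟨M, hM, ?_⟩
  rw [Real.sqrt_div (by positivity)]
  exact div_le_div₀ (projectiveNorm_nonneg M) hπ (injectiveNorm_pos hM) hε

/-- The standard basis of the vector space of the cubic model. -/
noncomputable def cubicBasis (n : ℕ) : Basis (Unit ⊕ Fin n) ℝ (ℝ × (Fin n → ℝ)) :=
  (Basis.singleton Unit ℝ).prod (Pi.basisFun ℝ (Fin n))

theorem abs_cubicBasis_coord_le {n : ℕ} (i : Unit ⊕ Fin n) {y : ℝ × (Fin n → ℝ)}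
    (hy : y ∈ (cubic n).cone) : |(cubicBasis n).coord i y| ≤ (cubic n).unit y := by
  have hy' : ‖y.2‖ ≤ y.1 := hy
  change _ ≤ y.1
  rcases i with i | i
  · simp [cubicBasis, abs_of_nonneg ((norm_nonneg _).trans hy')]
  · simpa [cubicBasis] using (norm_le_pi_norm y.2 i).trans hy'

/-- Vectors with all coordinates `±1` are vertices of the cube up to a global sign, fixed by the
scalar coordinate. Functionals between minus and plus the unit are thus bounded by one on their
products. -/
theorem sum_signs_mem_cubic {n : ℕ} (s : Unit ⊕ Fin n → ℤˣ) :
    ∃ a ∈ (cubic n).states, ∃ t : ℤˣ, ∑ i, ((s i : ℤ) : ℝ) • cubicBasis n i = ((t : ℤ) : ℝ) • a := by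
  have hmem : ∀ v : Fin n → ℝ, ‖v‖ ≤ 1 → ((1, v) : ℝ × (Fin n → ℝ)) ∈ (cubic n).states :=
    fun v hv => ⟨hv, rfl⟩
  have hv := norm_sum_signs_le fun i => s (Sum.inr i)
  have hsum : ∑ i, ((s i : ℤ) : ℝ) • cubicBasis n i = (((s (Sum.inl ()) : ℤ) : ℝ),
      ∑ i, ((s (Sum.inr i) : ℤ) : ℝ) • Pi.basisFun ℝ (Fin n) i) := by
    rw [Fintype.sum_sum_type]
    ext <;> simp [cubicBasis, Prod.fst_sum, Prod.snd_sum]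
  rw [hsum]
  rcases Int.units_eq_one_or (s (Sum.inl ())) with h | h
  · exact ⟨_, hmem _ hv, 1, by simp [h]⟩
  · exact ⟨_, hmem (-_) (by rwa [norm_neg]), -1, by simp [h]⟩

theorem distNorm_measurements_le_LO (n m : ℕ) (z : (ℝ × (Fin n → ℝ)) ⊗[ℝ] (ℝ × (Fin m → ℝ))) :
    distNorm ((cubic n).minTensor (cubic m)).measurements z
      ≤ √(2 * (min n m + 1 : ℕ)) * distNorm (measurementsLO (cubic n) (cubic m)) z := by
  have hA := centrallySymmetric_states_nonempty (E := Fin n → ℝ)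
  have hB := centrallySymmetric_states_nonempty (E := Fin m → ℝ)
  have hLO : measurementsLO (cubic n) (cubic m) ⊆ ((cubic n).minTensor (cubic m)).measurements :=
    (LocalClass.LO.measurements_subset hA hB).trans maxPositiveMeasurements_subset
  -- Every coordinate lies between minus and plus the unit effect, so it is the expectation value of
  -- a binary measurement; products of coordinates are then seen by LO.
  have hcoord : ∀ i j, |prodFunctional ((cubicBasis n).coord i) ((cubicBasis m).coord j) z|
      ≤ distNorm (measurementsLO (cubic n) (cubic m)) z := by
    intro i j
    obtain ⟨h1, h2⟩ := (cubic n).unit_sub_mem fun y hy => abs_cubicBasis_coord_le i hy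
    obtain ⟨h3, h4⟩ := (cubic m).unit_sub_mem fun y hy => abs_cubicBasis_coord_le j hy
    obtain ⟨X, hX, h⟩ := exists_mem_LO h1 h2 h3 h4
    exact (h z).trans (GPT.le_distNorm hLO hX z)
  refine GPT.distNorm_le (GPT.measurements_nonempty _) fun e he => ?_
  obtain ⟨f, h1, h2, hf⟩ := GPT.exists_eq_sum_abs _ he z
  rw [hf]
  have hsg : ∀ t : ℤˣ, |((t : ℤ) : ℝ)| = 1 := fun t => by
    rcases Int.units_eq_one_or t with rfl | rfl <;> simp
  have := dual_le_of_coords (cubicBasis n) (cubicBasis m) f (fun s t => by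
    obtain ⟨a, ha, σ, h3⟩ := sum_signs_mem_cubic s
    obtain ⟨b, hb, τ, h4⟩ := sum_signs_mem_cubic t
    rw [h3, h4, TensorProduct.smul_tmul_smul, map_smul, smul_eq_mul]
    refine (le_abs_self _).trans ?_
    rw [abs_mul, abs_mul, hsg, hsg, one_mul, one_mul]
    refine (GPT.abs_apply_tmul_le h1 h2 ha.1 hb.1).trans (le_of_eq ?_)
    rw [ha.2, hb.2, one_mul]) z hcoord ((abs_nonneg _).trans (hcoord (Sum.inl ()) (Sum.inl ())))
  have hcard : min (Fintype.card (Unit ⊕ Fin n)) (Fintype.card (Unit ⊕ Fin m)) = min n m + 1 := by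
    simp only [Fintype.card_sum, Fintype.card_unit, Fintype.card_fin]
    omega
  rwa [hcard] at this

theorem cubic_dim (n : ℕ) : (cubic n).dim = n + 1 := by
  simp [GPT.dim, add_comm]

theorem exists_restricted_ratio {n m : ℕ} (hn : 1 ≤ n) (hm : 1 ≤ m) :
    ∃ M : (Fin n → ℝ) ⊗[ℝ] (Fin m → ℝ), M ≠ 0 ∧
      (∀ N : (Fin n → ℝ) ⊗[ℝ] (Fin m → ℝ), N ≠ 0 →
        projectiveNorm N / injectiveNorm N ≤ projectiveNorm M / injectiveNorm M) ∧
      √((min n m : ℕ) / 2) ≤ projectiveNorm M / injectiveNorm M ∧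
      projectiveNorm M / injectiveNorm M ≤ √(2 * (min n m : ℕ)) := by
  obtain ⟨M₀, hM₀, h₀⟩ := exists_ratio_ge hn hm
  have : Nontrivial ((Fin n → ℝ) ⊗[ℝ] (Fin m → ℝ)) := ⟨M₀, 0, hM₀⟩
  obtain ⟨M, hM, hmax⟩ := exists_max_ratio (projectiveSeminorm (Fin n → ℝ) (Fin m → ℝ))
    (injectiveSeminorm (Fin n → ℝ) (Fin m → ℝ)) fun _ hx => injectiveNorm_pos hx
  refine ⟨M, hM, hmax, h₀.trans (hmax M₀ hM₀), ?_⟩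
  rw [div_le_iff₀ (injectiveNorm_pos hM)]
  exact projectiveNorm_le_injectiveNorm M

theorem exists_dataHidingRatio {n m : ℕ} (hn : 1 ≤ n) (hm : 1 ≤ m) (c : LocalClass) :
    ∃ R, IsGreatest (dataHidingEfficiencies ((cubic n).minTensor (cubic m))
        (c.measurements (cubic n) (cubic m) ((cubic n).minTensor (cubic m)))) R ∧
      √((min n m : ℕ) / 2) ≤ R ∧ R ≤ √(2 * (min n m + 1 : ℕ)) := by
  have hA : (cubic n).states.Nonempty := centrallySymmetric_states_nonempty
  have hB : (cubic m).states.Nonempty := centrallySymmetric_states_nonempty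
  have hsub := (c.measurements_subset hA hB).trans maxPositiveMeasurements_subset
  have hLO := c.measurementsLO_subset hA hB
  have hLO0 : (measurementsLO (cubic n) (cubic m)).Nonempty := by
    obtain ⟨h1, h2⟩ := (cubic n).unit_sub_mem fun y hy => abs_cubicBasis_coord_le (Sum.inl ()) hy
    obtain ⟨h3, h4⟩ := (cubic m).unit_sub_mem fun y hy => abs_cubicBasis_coord_le (Sum.inl ()) hy
    obtain ⟨X, hX, -⟩ := exists_mem_LO h1 h2 h3 h4
    exact ⟨X, hX⟩
  obtain ⟨R, hR, hle⟩ := GPT.exists_isGreatest_efficiencies _ (GPT.states_minTensor_nonempty hA hB)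
    hsub (hLO0.mono hLO) (c := √(2 * (min n m + 1 : ℕ))) fun z =>
      (distNorm_measurements_le_LO n m z).trans (mul_le_mul_of_nonneg_left
        (GPT.distNorm_mono hLO hsub hLO0 z) (Real.sqrt_nonneg _))
  refine ⟨R, hR, ?_, hle⟩
  obtain ⟨M, hM, h1⟩ := exists_ratio_ge hn hm
  exact h1.trans (hR.2 (ratio_mem_efficiencies c (injectiveNorm_pos hM)))

end Cubic

end DataHiding

/-! ### Assembly of the two parts. -/

theorem mainTheorem8 :
    (∀ n m : ℕ, 1 ≤ n → 1 ≤ m → ∃ Rbar : ℝ,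
      IsGreatest {r : ℝ | ∃ M : (Fin n → ℝ) ⊗[ℝ] (Fin m → ℝ), M ≠ 0 ∧
        r = DataHiding.projectiveNorm M / DataHiding.injectiveNorm M} Rbar ∧
      (∀ c : DataHiding.LocalClass,
        IsGreatest
          (DataHiding.restrictedRatios
            ((DataHiding.cubic n).minTensor (DataHiding.cubic m))
            (c.measurements (DataHiding.cubic n) (DataHiding.cubic m)
              ((DataHiding.cubic n).minTensor (DataHiding.cubic m)))) Rbar) ∧
      Real.sqrt ((min n m : ℕ) / 2) ≤ Rbar ∧ Rbar ≤ Real.sqrt (2 * (min n m : ℕ))) ∧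
    ∃ a b : ℝ, 0 < a ∧ 0 < b ∧
      ∀ n m : ℕ, 1 ≤ n → 1 ≤ m → ∀ c : DataHiding.LocalClass, ∃ R : ℝ,
        IsGreatest
          (DataHiding.dataHidingEfficiencies
            ((DataHiding.cubic n).minTensor (DataHiding.cubic m))
            (c.measurements (DataHiding.cubic n) (DataHiding.cubic m)
              ((DataHiding.cubic n).minTensor (DataHiding.cubic m)))) R ∧
        a * Real.sqrt (min n m : ℕ) ≤ R ∧ R ≤ b * Real.sqrt (min n m : ℕ) ∧
        a * Real.sqrt (min (DataHiding.cubic n).dim (DataHiding.cubic m).dim : ℕ) ≤ R ∧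
        R ≤ b * Real.sqrt (min (DataHiding.cubic n).dim (DataHiding.cubic m).dim : ℕ) := by
  refine ⟨fun n m hn hm => ?_, 1 / 2, 2, by norm_num, by norm_num, fun n m hn hm c => ?_⟩
  · obtain ⟨M, hM, hmax, h1, h2⟩ := DataHiding.exists_restricted_ratio hn hm
    have hgr : IsGreatest {r : ℝ | ∃ M : (Fin n → ℝ) ⊗[ℝ] (Fin m → ℝ), M ≠ 0 ∧
        r = DataHiding.projectiveNorm M / DataHiding.injectiveNorm M}
        (DataHiding.projectiveNorm M / DataHiding.injectiveNorm M) := by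
      refine ⟨⟨M, hM, rfl⟩, ?_⟩
      rintro _ ⟨N, hN, rfl⟩
      exact hmax N hN
    refine ⟨_, hgr, fun c => ?_, h1, h2⟩
    unfold DataHiding.cubic
    rw [DataHiding.restrictedRatios_eq]
    exact hgr
  · obtain ⟨R, hR, h1, h2⟩ := DataHiding.exists_dataHidingRatio hn hm c
    have hk : (1 : ℝ) ≤ (min n m : ℕ) := by exact_mod_cast le_min hn hm
    have hdim : min (DataHiding.cubic n).dim (DataHiding.cubic m).dim = min n m + 1 := by
      rw [DataHiding.cubic_dim, DataHiding.cubic_dim]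
      omega
    rw [hdim]
    set k : ℕ := min n m
    -- The constants `1 / 2` and `2` absorb the shift from `k` to `k + 1`: both inequalities below
    -- amount to `1 ≤ k`, with equality at `k = 1`.
    have hlow : 1 / 2 * √((k + 1 : ℕ) : ℝ) ≤ √((k : ℝ) / 2) := by
      refine Real.le_sqrt_of_sq_le ?_
      rw [mul_pow, Real.sq_sqrt (by positivity)]
      push_cast
      linarith
    have hup : √(2 * (k + 1 : ℕ) : ℝ) ≤ 2 * √(k : ℝ) := by
      refine Real.sqrt_le_iff.2 ⟨by positivity, ?_⟩
      rw [mul_pow, Real.sq_sqrt (by positivity)]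
      push_cast
      linarith
    have hmono : √(k : ℝ) ≤ √((k + 1 : ℕ) : ℝ) := Real.sqrt_le_sqrt (by push_cast; linarith)
    exact ⟨R, hR, by linarith, by linarith, by linarith, by linarith⟩
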